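/- A closed flat folded ribbon of width $w>0$ is given by a closed polygon in the plane (its centre line) with a genuine fold at every vertex: the fold line at a vertex is the part, within distance $w/2$ of the lines carrying the two adjacent edges of the polygon, of the line through that vertex perpendicular to the bisector of the angle there; successive fold lines are disjoint, and they cut the strip of width $w$ centred on the centre line into pieces, one for each edge. The pieces are layered consistently: over each piece without the ribbon's two edges there is a continuous height function, the heights of successive pieces agree along their common fold line, and two points of the ribbon (without its edges) over the same point of the plane have equal heights only if they are the same point of the ribbon. (The ribbon has no thickness, and its edges may touch other parts of it.) The ribbon ties the knot that its centre line, lifted to space by the heights, forms up to ambient isotopy. Its length $L$ is the length of the centre line, and the (closed) Ribbonlength of a knot is the infimum of $L/w$ over all closed flat folded ribbons tying it. The $(p,r)$ torus knot (for coprime $p,r$) lies on a standard torus in space, winding $p$ times meridionally and $r$ times longitudinally. Let $q>1$ be an integer. For every $w>0$ the $(2q+1,q)$ torus knot can be tied by a closed flat folded ribbon of width $w$ that consists of exactly $2q+1$ pieces and forms a "pinwheel" of congruent isosceles trapezoids: each piece is an isosceles trapezoid of height $w$ with base $b = \frac{2w}{\sin(\pi/(2q+1))}$ and top $t = 2w\cot\frac{\pi}{2q+1}$,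 where $0<t<b$; there is a common centre which is the midpoint of the base of every piece; each piece arises from the preceding one by one and the same rotation about the centre, of order exactly $2q+1$; and the union of the pieces is not convex. The length to width ratio of this ribbon is $$\frac{L}{w} = (2q+1)\cot\frac{\pi}{2(2q+1)}.$$ Consequently the Ribbonlength of the $(2q+1,q)$ torus knot is at most $(2q+1)\cot\frac{\pi}{2(2q+1)}$. -/

import Mathlib

open scoped ENNReal

noncomputable section

namespace RibbonKnot

/-! The plane is `ℂ` and three-space is `ℂ × ℝ` (a point of the plane together with a height). -/

/-- Two subsets of three-space are ambient isotopic: some continuous family of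
self-homeomorphisms of space starts at the identity and carries the first set to the second. -/
def AmbientIsotopic (K K' : Set (ℂ × ℝ)) : Prop :=
  ∃ H : unitInterval → (ℂ × ℝ) ≃ₜ (ℂ × ℝ),
    Continuous (fun p : unitInterval × (ℂ × ℝ) => H p.1 p.2) ∧
    (∀ x, H 0 x = x) ∧ H 1 '' K = K'

/-- The `(p, q)` torus knot (for coprime `p`, `q`): it lies on the standard torus around the
vertical axis, winding `p` times meridionally and `q` times longitudinally (around the axis). -/
def torusKnot (p q : ℕ) : Set (ℂ × ℝ) :=
  Set.range fun s : ℝ =>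
    (((2 + Real.cos (p * s) : ℝ) : ℂ) * Complex.exp (((q * s : ℝ) : ℂ) * Complex.I),
      -Real.sin (p * s))

/-- The data of a closed ribbon folded flat into the plane with `n` folds: the closed polygon
`vertex` traced by its centre line, its width, and for each of its `n` straight pieces the
height at which the piece lies over (or under) the points of the plane that it covers.
Only the values of `height i` over the `i`-th piece matter. -/
structure ClosedRibbon (n : ℕ) where
  vertex : ZMod n → ℂ
  width : ℝ
  height : ZMod n → ℂ → ℝ

namespace ClosedRibbon

variable {n : ℕ} (R : ClosedRibbon n)

/-- The unit direction of the centre line from vertex `i` to vertex `i + 1`. -/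
def dir (i : ZMod n) : ℂ :=
  (R.vertex (i + 1) - R.vertex i) / (‖R.vertex (i + 1) - R.vertex i‖ : ℂ)

/-- The signed distance of `z` from the line carrying the `i`-th edge of the centre line. -/
def offset (i : ZMod n) (z : ℂ) : ℝ :=
  inner ℝ (Complex.I * R.dir i) (z - R.vertex i)

/-- The fold line at vertex `i`: the part, inside the ribbon, of the line through the vertex
that is perpendicular to the bisector of the angle of the centre line there.
(The reflection in that line takes the incoming direction to the outgoing one.) -/
def crease (i : ZMod n) : Set ℂ :=
  {z | inner ℝ (R.dir i - R.dir (i - 1)) (z - R.vertex i) = 0 ∧ |R.offset i z| ≤ R.width / 2}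

/-- The `i`-th piece of the folded ribbon: the part of the strip of the given width around the
`i`-th edge that lies between the fold lines at vertices `i` and `i + 1`. -/
def piece (i : ZMod n) : Set ℂ :=
  {z | |R.offset i z| ≤ R.width / 2 ∧
    0 ≤ inner ℝ (R.dir i - R.dir (i - 1)) (z - R.vertex i) ∧
    0 ≤ inner ℝ (R.dir (i + 1) - R.dir i) (z - R.vertex (i + 1))}

/-- The `i`-th piece without the two edges of the ribbon (but with its fold lines). -/
def openPiece (i : ZMod n) : Set ℂ :=
  {z ∈ R.piece i | |R.offset i z| < R.width / 2}

/-- The data describe a closed ribbon folded flat. There is a genuine fold at every vertex,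
successive fold lines are disjoint, the heights are continuous and fit together along the fold
lines, and the ribbon does not meet itself: two points of the ribbon that lie over the same
point of the plane at the same height are the same point of the ribbon, i.e. they are equal, or
are identified along a common fold line. The ribbon has no thickness and its edges may be in
contact with other parts of it, so the heights concern the ribbon without its edges. -/
structure IsFlatFolded : Prop where
  width_pos : 0 < R.width
  edge_ne : ∀ i, R.vertex i ≠ R.vertex (i + 1)
  fold : ∀ i, R.dir i ≠ R.dir (i - 1)
  crease_disjoint : ∀ i, Disjoint (R.crease i) (R.crease (i + 1))
  height_continuous : ∀ i, ContinuousOn (R.height i) (R.openPiece i)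
  height_crease : ∀ i, ∀ z ∈ R.crease i, |R.offset i z| < R.width / 2 →
    R.height (i - 1) z = R.height i z
  height_injective : ∀ i j z, z ∈ R.openPiece i → z ∈ R.openPiece j →
    R.height i z = R.height j z →
      i = j ∨ (j = i + 1 ∧ z ∈ R.crease j) ∨ (i = j + 1 ∧ z ∈ R.crease i)

/-- The knot tied by the ribbon: its centre line in space. -/
def knot : Set (ℂ × ℝ) :=
  {x | ∃ i, x.1 ∈ segment ℝ (R.vertex i) (R.vertex (i + 1)) ∧ x.2 = R.height i x.1}

/-- The length of the ribbon, measured along its centre line. -/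
def length [NeZero n] : ℝ :=
  ∑ i : ZMod n, dist (R.vertex i) (R.vertex (i + 1))

end ClosedRibbon

/-- The (closed) Ribbonlength of a knot: the infimum of the length to width ratios of the closed
flat folded ribbons that tie it (`∞` if there is none). -/
def ribbonlength (K : Set (ℂ × ℝ)) : ℝ≥0∞ :=
  sInf {x | ∃ (n : ℕ) (_ : NeZero n) (R : ClosedRibbon n), R.IsFlatFolded ∧
    AmbientIsotopic R.knot K ∧ x = ENNReal.ofReal (R.length / R.width)}

/-- The isosceles trapezoid with base `b`, top `t` and height `w` whose base has midpoint `0`. -/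
def isoTrapezoid (b t w : ℝ) : Set ℂ :=
  convexHull ℝ {(⟨-b / 2, 0⟩ : ℂ), ⟨b / 2, 0⟩, ⟨t / 2, w⟩, ⟨-t / 2, w⟩}

/-- The folded ribbon is a pinwheel of `n` congruent isosceles trapezoids with base `b` and top
`t`: each piece is such a trapezoid, with the midpoint of its base at a common centre `c`; each
piece arises from the preceding one by the same rotation about `c`, of exact order `n`; and
together the pieces do not fill a convex polygon. -/
def ClosedRibbon.IsPinwheel {n : ℕ} (R : ClosedRibbon n) (b t : ℝ) : Prop :=
  0 < t ∧ t < b ∧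
  ∃ c : ℂ,
    (∀ i, ∃ e : ℂ ≃ᵢ ℂ, e 0 = c ∧ R.piece i = e '' isoTrapezoid b t R.width) ∧
    (∃ m : ℕ, m.Coprime n ∧ ∀ i, R.piece (i + 1) =
      (fun z : ℂ => c + Complex.exp (2 * Real.pi * m / n * Complex.I) * (z - c)) '' R.piece i) ∧
    ¬ Convex ℝ (⋃ i, R.piece i)

end RibbonKnot

end

noncomputable section

namespace RibbonKnot

/-! Put n = 2q + 1, ε = `tilt q` = π / (2n), β = `halfAngle q` = π/2 - ε and ρ = `circumradius q w`.
The centre line is the star polygon {n/q} with edges at distance w/2 from its centre, so one border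
of every strip passes through the centre. In the `frame` of an edge the strip is 0 ≤ re ≤ w, the
edge is re = w/2, and the fold lines lie on the tangents of the circumscribed circle at the two ends
of the edge. Each piece is then a trapezoid whose base is centred at the origin, and an edge has
length 2ρ cos ε, which gives L/w = n cot ε.

All pieces carry one height function, `sheetHeight`, read in their own frames. It is an angular
factor sin(πθ / (2β)) times a nonnegative `creaseFactor`. Over a given point of the plane, two
pieces see the same radius and angles that differ by a multiple of 4ε. If the two angles have the
same sign, the radius is below w / sin 4ε < ρ. There `creaseFactor` is positive and depends on the
radius alone, and the angular factors differ (`angleFactor_ne`). If the signs are opposite, equal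
heights must both be 0, which happens only on fold lines; `eq_of_crease` shows that the pieces are
then successive. This is `sheetHeight_eq_imp`, the core of `starRibbon_isFlatFolded`.

The summand with `creaseGap` separates the sheets outside the circumscribed circle, where
`radialFactor` is 0. It vanishes on the fold lines, so successive pieces fit there at height 0, and
on the centre line, where the double angle formula leaves the height sin(πx) at angle βx. The torus
knot has the same heights at the same polar angles, so an increasing change of the radius carries
one curve to the other, and interpolation with the identity is an ambient isotopy
(`starRibbon_knot_ambientIsotopic`).

The union is not convex because the midpoint between two neighbouring outer corners lies in no piece
(`not_convex_iUnion_piece`). -/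

/-- Half the angle between the legs of a trapezoid of the pinwheel with `2 * q + 1` pieces. -/
def tilt (q : ℕ) : ℝ := Real.pi / (2 * (2 * q + 1))

/-- Half the angle that an edge of the star polygon `{2 * q + 1 / q}` subtends at its centre. -/
def halfAngle (q : ℕ) : ℝ := 2 * q * tilt q

/-- The circumradius of the star polygon whose edges are at distance `w / 2` from its centre. -/
def circumradius (q : ℕ) (w : ℝ) : ℝ := w / 2 / Real.sin (tilt q)

/-- The unit vector pointing to the `i`-th vertex of the star polygon. -/
def vertexDir (q : ℕ) (i : ZMod (2 * q + 1)) : ℂ := ZMod.stdAddChar ((q : ZMod (2 * q + 1)) * i)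

/-- The unit vector at angle `halfAngle q`. -/
def halfTurn (q : ℕ) : ℂ := Complex.exp (halfAngle q * Complex.I)

/-- The unit vector pointing to the midpoint of the `i`-th edge of the star polygon. -/
def edgeDir (q : ℕ) (i : ZMod (2 * q + 1)) : ℂ := vertexDir q i * halfTurn q

/-- The coordinate of `z` in the frame in which the midpoint of the `i`-th edge lies on the
positive real axis. -/
def frame (q : ℕ) (i : ZMod (2 * q + 1)) (z : ℂ) : ℂ := z * (starRingEnd ℂ) (edgeDir q i)

/-! ### Angles of the star polygon and rotated frames -/

lemma two_mul_add_one_mul_tilt (q : ℕ) : (2 * q + 1) * tilt q = Real.pi / 2 := by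
  unfold tilt; field_simp

lemma halfAngle_add_tilt (q : ℕ) : halfAngle q + tilt q = Real.pi / 2 := by
  rw [← two_mul_add_one_mul_tilt q, halfAngle]; ring

lemma tilt_pos (q : ℕ) : 0 < tilt q := by
  have := Real.pi_pos
  unfold tilt; positivity

/-- Since n ≥ 5, even 10ε ≤ π. This is the quantitative form in which q > 1 enters the trigonometric
estimates. -/
lemma tilt_lt {q : ℕ} (hq : 1 < q) : 9 * tilt q < Real.pi := by
  have h1 := two_mul_add_one_mul_tilt q
  have h2 := tilt_pos q
  have h3 : (2 : ℝ) ≤ q := by exact_mod_cast hq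
  nlinarith

lemma sin_tilt_pos {q : ℕ} (hq : 1 < q) : 0 < Real.sin (tilt q) :=
  Real.sin_pos_of_pos_of_lt_pi (tilt_pos q) (by linarith [tilt_lt hq, tilt_pos q])

lemma cos_tilt_pos {q : ℕ} (hq : 1 < q) : 0 < Real.cos (tilt q) :=
  Real.cos_pos_of_mem_Ioo ⟨by linarith [tilt_pos q, Real.pi_pos], by
    linarith [tilt_lt hq, tilt_pos q]⟩

lemma cos_halfAngle (q : ℕ) : Real.cos (halfAngle q) = Real.sin (tilt q) := by
  rw [← Real.cos_pi_div_two_sub, ← halfAngle_add_tilt q, add_sub_cancel_right]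

lemma sin_halfAngle (q : ℕ) : Real.sin (halfAngle q) = Real.cos (tilt q) := by
  rw [← Real.sin_pi_div_two_sub, ← halfAngle_add_tilt q, add_sub_cancel_right]

lemma halfAngle_pos {q : ℕ} (hq : 1 < q) : 0 < halfAngle q := by
  linarith [halfAngle_add_tilt q, tilt_lt hq, tilt_pos q]

lemma halfAngle_lt (q : ℕ) : halfAngle q < Real.pi / 2 := by
  linarith [halfAngle_add_tilt q, tilt_pos q]

lemma two_mul_sin_tilt_sq_lt {q : ℕ} (hq : 1 < q) : 2 * Real.sin (tilt q) ^ 2 < 1 := by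
  have : 0 < Real.cos (2 * tilt q) := Real.cos_pos_of_mem_Ioo
    ⟨by linarith [tilt_pos q, Real.pi_pos], by linarith [tilt_lt hq, tilt_pos q]⟩
  rw [Real.cos_two_mul, Real.cos_sq'] at this
  linarith

lemma circumradius_mul_sin {q : ℕ} (hq : 1 < q) (w : ℝ) :
    circumradius q w * Real.sin (tilt q) = w / 2 :=
  div_mul_cancel₀ _ (sin_tilt_pos hq).ne'

lemma circumradius_pos {q : ℕ} (hq : 1 < q) {w : ℝ} (hw : 0 < w) : 0 < circumradius q w :=
  div_pos (half_pos hw) (sin_tilt_pos hq)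

lemma halfTurn_re (q : ℕ) : (halfTurn q).re = Real.sin (tilt q) := by
  rw [halfTurn, Complex.exp_ofReal_mul_I_re, cos_halfAngle]

lemma halfTurn_im (q : ℕ) : (halfTurn q).im = Real.cos (tilt q) := by
  rw [halfTurn, Complex.exp_ofReal_mul_I_im, sin_halfAngle]

lemma halfTurn_mul_conj (q : ℕ) : halfTurn q * (starRingEnd ℂ) (halfTurn q) = 1 := by
  rw [Complex.mul_conj, Complex.normSq_eq_norm_sq, halfTurn, Complex.norm_exp_ofReal_mul_I]
  simp

lemma vertexDir_mul_conj (q : ℕ) (i : ZMod (2 * q + 1)) :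
    vertexDir q i * (starRingEnd ℂ) (vertexDir q i) = 1 := by
  rw [Complex.mul_conj, Complex.normSq_eq_norm_sq, vertexDir, ZMod.stdAddChar_apply,
    Circle.norm_coe]
  simp

lemma edgeDir_mul_conj (q : ℕ) (i : ZMod (2 * q + 1)) :
    edgeDir q i * (starRingEnd ℂ) (edgeDir q i) = 1 := by
  rw [edgeDir, map_mul]
  linear_combination halfTurn_mul_conj q * vertexDir q i * (starRingEnd ℂ) (vertexDir q i) +
    vertexDir_mul_conj q i

lemma norm_edgeDir (q : ℕ) (i : ZMod (2 * q + 1)) : ‖edgeDir q i‖ = 1 := by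
  rw [edgeDir, norm_mul, halfTurn, Complex.norm_exp_ofReal_mul_I, vertexDir,
    ZMod.stdAddChar_apply, Circle.norm_coe, mul_one]

lemma vertexDir_add (q : ℕ) (i j : ZMod (2 * q + 1)) :
    vertexDir q (i + j) = vertexDir q i * vertexDir q j := by
  rw [vertexDir, mul_add, AddChar.map_add_eq_mul, vertexDir, vertexDir]

lemma vertexDir_intCast (q : ℕ) (j : ℤ) :
    vertexDir q j = Complex.exp ((2 * halfAngle q * j : ℝ) * Complex.I) := by
  have h : ((q : ZMod (2 * q + 1)) * (j : ZMod (2 * q + 1))) = ((q * j : ℤ) : ZMod (2 * q + 1)) := by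
    push_cast; rfl
  rw [vertexDir, h, ZMod.stdAddChar_coe]
  congr 1
  have : (2 * (q : ℂ) + 1) ≠ 0 := by exact_mod_cast (Nat.succ_ne_zero (2 * q))
  unfold halfAngle tilt
  push_cast
  field_simp

lemma vertexDir_one (q : ℕ) : vertexDir q 1 = halfTurn q ^ 2 := by
  have := vertexDir_intCast q 1
  rw [Int.cast_one] at this
  rw [this, halfTurn, ← Complex.exp_nat_mul]
  congr 1
  push_cast
  ring

lemma vertexDir_add_one (q : ℕ) (i : ZMod (2 * q + 1)) :
    vertexDir q (i + 1) = vertexDir q i * halfTurn q ^ 2 := by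
  rw [vertexDir_add, vertexDir_one]

lemma frame_mul_edgeDir (q : ℕ) (i : ZMod (2 * q + 1)) (z : ℂ) :
    frame q i z * edgeDir q i = z := by
  rw [frame]; linear_combination z * edgeDir_mul_conj q i

lemma frame_edgeDir_mul (q : ℕ) (i : ZMod (2 * q + 1)) (z : ℂ) :
    frame q i (z * edgeDir q i) = z := by
  rw [frame]; linear_combination z * edgeDir_mul_conj q i

lemma norm_frame (q : ℕ) (i : ZMod (2 * q + 1)) (z : ℂ) : ‖frame q i z‖ = ‖z‖ := by
  conv_rhs => rw [← frame_mul_edgeDir q i z, norm_mul, norm_edgeDir, mul_one]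

/-- Turning the frame of an edge by ±β puts an end of the edge on the positive real axis. The result
depends only on that vertex, which lets adjacent frames be compared. -/
lemma frame_mul_halfTurn (q : ℕ) (i : ZMod (2 * q + 1)) (z : ℂ) :
    frame q i z * halfTurn q = (starRingEnd ℂ) (vertexDir q i) * z := by
  rw [frame, edgeDir, map_mul]
  linear_combination z * (starRingEnd ℂ) (vertexDir q i) * halfTurn_mul_conj q

lemma frame_mul_conj_halfTurn (q : ℕ) (i : ZMod (2 * q + 1)) (z : ℂ) :
    frame q i z * (starRingEnd ℂ) (halfTurn q) = (starRingEnd ℂ) (vertexDir q (i + 1)) * z := by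
  rw [frame, edgeDir, vertexDir_add_one, map_mul, map_mul, map_pow]
  ring

lemma frame_mul_halfTurn_re (q : ℕ) (ζ : ℂ) :
    (ζ * halfTurn q).re = ζ.re * Real.sin (tilt q) - ζ.im * Real.cos (tilt q) := by
  rw [Complex.mul_re, halfTurn_re, halfTurn_im]

lemma frame_mul_conj_halfTurn_re (q : ℕ) (ζ : ℂ) :
    (ζ * (starRingEnd ℂ) (halfTurn q)).re =
      ζ.re * Real.sin (tilt q) + ζ.im * Real.cos (tilt q) := by
  rw [Complex.mul_re, Complex.conj_re, Complex.conj_im, halfTurn_re, halfTurn_im]; ring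

lemma halfTurn_sub_conj (q : ℕ) :
    halfTurn q - (starRingEnd ℂ) (halfTurn q) = 2 * Real.cos (tilt q) * Complex.I := by
  rw [Complex.sub_conj, halfTurn_im]; push_cast; ring

/-! ### Offsets, folds and pieces of the star ribbon in frame coordinates -/

/-- A ribbon whose centre line is the star polygon `{2 * q + 1 / q}`, with the same height
function `h` over each piece, in the frame of the piece. -/
def starRibbon (q : ℕ) (w : ℝ) (h : ℂ → ℝ) : ClosedRibbon (2 * q + 1) where
  vertex i := circumradius q w * vertexDir q i
  width := w
  height i z := h (frame q i z)

section Geometry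

variable {q : ℕ} (hq : 1 < q) {w : ℝ} (hw : 0 < w) (h : ℂ → ℝ)

lemma starRibbon_vertex (i : ZMod (2 * q + 1)) :
    (starRibbon q w h).vertex i = circumradius q w * vertexDir q i := rfl

lemma starRibbon_vertex_eq (i : ZMod (2 * q + 1)) : (starRibbon q w h).vertex i =
    circumradius q w * (starRingEnd ℂ) (halfTurn q) * edgeDir q i := by
  rw [starRibbon_vertex, edgeDir]
  linear_combination -circumradius q w * vertexDir q i * halfTurn_mul_conj q

lemma starRibbon_vertex_add_one (i : ZMod (2 * q + 1)) : (starRibbon q w h).vertex (i + 1) =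
    circumradius q w * halfTurn q * edgeDir q i := by
  rw [starRibbon_vertex, edgeDir, vertexDir_add_one]
  ring

lemma starRibbon_edge (i : ZMod (2 * q + 1)) :
    (starRibbon q w h).vertex (i + 1) - (starRibbon q w h).vertex i =
      (2 * circumradius q w * Real.cos (tilt q) : ℝ) * (Complex.I * edgeDir q i) := by
  rw [starRibbon_vertex_add_one, starRibbon_vertex_eq]
  simp only [Complex.ofReal_mul, Complex.ofReal_ofNat]
  linear_combination circumradius q w * edgeDir q i * halfTurn_sub_conj q

include hq hw in
lemma norm_starRibbon_edge (i : ZMod (2 * q + 1)) :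
    ‖(starRibbon q w h).vertex (i + 1) - (starRibbon q w h).vertex i‖ =
      2 * circumradius q w * Real.cos (tilt q) := by
  have h1 := circumradius_pos hq hw
  have h2 := cos_tilt_pos hq
  rw [starRibbon_edge, norm_mul, norm_mul, Complex.norm_I, norm_edgeDir, Complex.norm_real,
    Real.norm_of_nonneg (by positivity)]
  ring

include hq hw in
lemma starRibbon_dir (i : ZMod (2 * q + 1)) :
    (starRibbon q w h).dir i = Complex.I * edgeDir q i := by
  have h1 := circumradius_pos hq hw
  have h2 := cos_tilt_pos hq
  rw [ClosedRibbon.dir, norm_starRibbon_edge hq hw, starRibbon_edge, mul_div_cancel_left₀]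
  exact_mod_cast (by positivity : 2 * circumradius q w * Real.cos (tilt q) ≠ 0)

include hq hw in
lemma starRibbon_offset (i : ZMod (2 * q + 1)) (z : ℂ) :
    (starRibbon q w h).offset i z = w / 2 - (frame q i z).re := by
  rw [ClosedRibbon.offset, starRibbon_dir hq hw, starRibbon_vertex_eq, Complex.inner]
  have e : (starRingEnd ℂ) (Complex.I * (Complex.I * edgeDir q i)) *
      (z - circumradius q w * (starRingEnd ℂ) (halfTurn q) * edgeDir q i) =
      circumradius q w * (starRingEnd ℂ) (halfTurn q) - frame q i z := by
    simp only [map_mul, Complex.conj_I, frame]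
    linear_combination (z * (starRingEnd ℂ) (edgeDir q i) - circumradius q w *
      (starRingEnd ℂ) (halfTurn q) * edgeDir q i * (starRingEnd ℂ) (edgeDir q i)) *
      Complex.I_mul_I + circumradius q w * (starRingEnd ℂ) (halfTurn q) * edgeDir_mul_conj q i
  rw [mul_comm, e, Complex.sub_re, Complex.re_ofReal_mul, Complex.conj_re, halfTurn_re,
    circumradius_mul_sin hq]

include hq hw in
lemma starRibbon_dir_sub (i : ZMod (2 * q + 1)) :
    (starRibbon q w h).dir i - (starRibbon q w h).dir (i - 1) =
      (-(2 * Real.cos (tilt q)) : ℝ) * vertexDir q i := by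
  rw [starRibbon_dir hq hw, starRibbon_dir hq hw]
  have e : edgeDir q (i - 1) = vertexDir q i * (starRingEnd ℂ) (halfTurn q) := by
    have := vertexDir_add_one q (i - 1)
    rw [sub_add_cancel] at this
    rw [this, edgeDir]
    linear_combination -vertexDir q (i - 1) * halfTurn q * halfTurn_mul_conj q
  rw [e, edgeDir]
  simp only [Complex.ofReal_neg, Complex.ofReal_mul, Complex.ofReal_ofNat]
  linear_combination Complex.I * vertexDir q i * halfTurn_sub_conj q +
    2 * Real.cos (tilt q) * vertexDir q i * Complex.I_mul_I

include hq hw in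
lemma starRibbon_inner_fold (i : ZMod (2 * q + 1)) (z : ℂ) :
    inner ℝ ((starRibbon q w h).dir i - (starRibbon q w h).dir (i - 1))
      (z - (starRibbon q w h).vertex i) =
      2 * Real.cos (tilt q) * (circumradius q w - (frame q i z * halfTurn q).re) := by
  rw [starRibbon_dir_sub hq hw, frame_mul_halfTurn, starRibbon_vertex, Complex.inner, map_mul,
    Complex.conj_ofReal]
  have e : ((-(2 * Real.cos (tilt q)) : ℝ) : ℂ) * (starRingEnd ℂ) (vertexDir q i) *
      (z - circumradius q w * vertexDir q i) = ((2 * Real.cos (tilt q) : ℝ) : ℂ) *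
      ((circumradius q w : ℝ) - (starRingEnd ℂ) (vertexDir q i) * z) := by
    push_cast
    linear_combination 2 * Complex.cos (tilt q) * circumradius q w * vertexDir_mul_conj q i
  rw [mul_comm, e, Complex.re_ofReal_mul, Complex.sub_re, Complex.ofReal_re]

include hq hw in
lemma starRibbon_inner_fold_add_one (i : ZMod (2 * q + 1)) (z : ℂ) :
    inner ℝ ((starRibbon q w h).dir (i + 1) - (starRibbon q w h).dir i)
      (z - (starRibbon q w h).vertex (i + 1)) =
      2 * Real.cos (tilt q) *
        (circumradius q w - (frame q i z * (starRingEnd ℂ) (halfTurn q)).re) := by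
  have := starRibbon_inner_fold hq hw h (i + 1) z
  rwa [add_sub_cancel_right, frame_mul_halfTurn, ← frame_mul_conj_halfTurn] at this

include hq hw in
-- The direction turns at a vertex by a negative multiple of the radius vector there, so the fold
-- conditions bound the piece by tangents of the circumscribed circle.
lemma mem_starRibbon_piece (i : ZMod (2 * q + 1)) (z : ℂ) :
    z ∈ (starRibbon q w h).piece i ↔ (0 ≤ (frame q i z).re ∧ (frame q i z).re ≤ w) ∧
      (frame q i z).re * Real.sin (tilt q) - (frame q i z).im * Real.cos (tilt q) ≤
        circumradius q w ∧
      (frame q i z).re * Real.sin (tilt q) + (frame q i z).im * Real.cos (tilt q) ≤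
        circumradius q w := by
  have h2 := cos_tilt_pos hq
  rw [ClosedRibbon.piece, Set.mem_ofPred_eq, starRibbon_inner_fold hq hw,
    starRibbon_inner_fold_add_one hq hw, starRibbon_offset hq hw, frame_mul_halfTurn_re,
    frame_mul_conj_halfTurn_re, mul_nonneg_iff_of_pos_left (by positivity),
    mul_nonneg_iff_of_pos_left (by positivity), sub_nonneg, sub_nonneg, abs_le]
  refine and_congr_left fun _ => ?_
  change _ ≤ _ ∧ _ ≤ w / 2 ↔ _
  rw [show (starRibbon q w h).width = w from rfl]
  constructor <;> rintro ⟨h3, h4⟩ <;> constructor <;> linarith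

include hq hw in
lemma starRibbon_abs_offset_lt (i : ZMod (2 * q + 1)) (z : ℂ) :
    |(starRibbon q w h).offset i z| < (starRibbon q w h).width / 2 ↔
      0 < (frame q i z).re ∧ (frame q i z).re < w := by
  rw [starRibbon_offset hq hw, abs_lt, show (starRibbon q w h).width = w from rfl]
  constructor <;> rintro ⟨h3, h4⟩ <;> constructor <;> linarith

include hq hw in
lemma mem_starRibbon_openPiece (i : ZMod (2 * q + 1)) (z : ℂ) :
    z ∈ (starRibbon q w h).openPiece i ↔ (0 < (frame q i z).re ∧ (frame q i z).re < w) ∧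
      (frame q i z).re * Real.sin (tilt q) - (frame q i z).im * Real.cos (tilt q) ≤
        circumradius q w ∧
      (frame q i z).re * Real.sin (tilt q) + (frame q i z).im * Real.cos (tilt q) ≤
        circumradius q w := by
  rw [ClosedRibbon.openPiece, Set.mem_sep_iff, mem_starRibbon_piece hq hw,
    starRibbon_abs_offset_lt hq hw]
  constructor
  · rintro ⟨⟨_, h1⟩, h2⟩; exact ⟨h2, h1⟩
  · rintro ⟨h2, h1⟩; exact ⟨⟨⟨h2.1.le, h2.2.le⟩, h1⟩, h2⟩

include hq hw in
lemma mem_starRibbon_crease (i : ZMod (2 * q + 1)) (z : ℂ) :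
    z ∈ (starRibbon q w h).crease i ↔
      (frame q i z).re * Real.sin (tilt q) - (frame q i z).im * Real.cos (tilt q) =
        circumradius q w ∧ 0 ≤ (frame q i z).re ∧ (frame q i z).re ≤ w := by
  have h2 := cos_tilt_pos hq
  rw [ClosedRibbon.crease, Set.mem_ofPred_eq, starRibbon_inner_fold hq hw,
    starRibbon_offset hq hw, frame_mul_halfTurn_re, mul_eq_zero, sub_eq_zero, eq_comm,
    or_iff_right (by positivity), abs_le, show (starRibbon q w h).width = w from rfl]
  constructor <;> rintro ⟨h3, h4, h5⟩ <;> refine ⟨?_, ?_, ?_⟩ <;> linarith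

/-- Reading the frame of the preceding piece off that of the current one, on their crease. -/
lemma frame_crease (i : ZMod (2 * q + 1)) (z : ℂ) :
    frame q i z * halfTurn q = frame q (i - 1) z * (starRingEnd ℂ) (halfTurn q) := by
  rw [frame_mul_halfTurn, frame_mul_conj_halfTurn, sub_add_cancel]

end Geometry

/-! ### The height function and the separation of overlapping sheets -/

/-- A piece of the pinwheel without the edges of the ribbon, in its own frame. -/
def openSheet (q : ℕ) (w : ℝ) : Set ℂ :=
  {ζ | (0 < ζ.re ∧ ζ.re < w) ∧
    ζ.re * Real.sin (tilt q) - ζ.im * Real.cos (tilt q) ≤ circumradius q w ∧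
    ζ.re * Real.sin (tilt q) + ζ.im * Real.cos (tilt q) ≤ circumradius q w}

/-- The angle at which the centre line of a piece meets the circle of radius `r` about the centre
of the pinwheel, for the radii `r` at which it does. -/
def chordAngle (q : ℕ) (w r : ℝ) : ℝ := Real.arccos (max (w / 2 / r) (Real.sin (tilt q)))

/-- A function of the radius that vanishes from the circumradius on. -/
def radialFactor (q : ℕ) (w r : ℝ) : ℝ :=
  2 * Real.cos (Real.pi * chordAngle q w r / (2 * halfAngle q))

/-- A function that vanishes on the centre line and, outside the circumscribed circle of the star
polygon, measures the distance from the fold lines. -/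
def creaseGap (q : ℕ) (w : ℝ) (ζ : ℂ) : ℝ :=
  Real.cos (tilt q) * (Real.sqrt (min ‖ζ‖ (circumradius q w) ^ 2 - (w / 2) ^ 2) - |ζ.im|) +
    Real.sin (tilt q) * (w / 2 - ζ.re)

/-- The second factor of the height function. -/
def creaseFactor (q : ℕ) (w : ℝ) (ζ : ℂ) : ℝ :=
  radialFactor q w ‖ζ‖ + max 0 (‖ζ‖ - w / Real.sin (4 * tilt q)) * |creaseGap q w ζ|

/-- The height of a piece of the pinwheel, in its own frame. -/
def sheetHeight (q : ℕ) (w : ℝ) (ζ : ℂ) : ℝ :=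
  Real.sin (Real.pi * ζ.arg / (2 * halfAngle q)) * creaseFactor q w ζ

lemma chordAngle_nonneg (q : ℕ) (w r : ℝ) : 0 ≤ chordAngle q w r := Real.arccos_nonneg _

lemma arccos_sin_tilt {q : ℕ} (hq : 1 < q) : Real.arccos (Real.sin (tilt q)) = halfAngle q := by
  rw [← cos_halfAngle, Real.arccos_cos (halfAngle_pos hq).le
    (by linarith [halfAngle_lt q, Real.pi_pos])]

lemma chordAngle_le {q : ℕ} (hq : 1 < q) (w r : ℝ) : chordAngle q w r ≤ halfAngle q := by
  rw [← arccos_sin_tilt hq]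
  exact Real.antitone_arccos (le_max_right _ _)

lemma circumradius_le_iff {q : ℕ} (hq : 1 < q) {w r : ℝ} (hr : 0 < r) :
    circumradius q w ≤ r ↔ w / 2 / r ≤ Real.sin (tilt q) := by
  rw [circumradius, div_le_iff₀ (sin_tilt_pos hq), div_le_iff₀ hr, mul_comm]

lemma chordAngle_of_circumradius_le {q : ℕ} (hq : 1 < q) {w r : ℝ} (hr : 0 < r)
    (h : circumradius q w ≤ r) : chordAngle q w r = halfAngle q := by
  rw [chordAngle, max_eq_right ((circumradius_le_iff hq hr).1 h), arccos_sin_tilt hq]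

lemma chordAngle_lt {q : ℕ} (hq : 1 < q) {w r : ℝ} (hr : 0 < r)
    (h : r < circumradius q w) : chordAngle q w r < halfAngle q := by
  have h1 : Real.sin (tilt q) < w / 2 / r := by
    rw [← not_le] at h ⊢
    rwa [← circumradius_le_iff hq hr]
  rw [chordAngle, max_eq_left h1.le]
  rcases le_or_gt (w / 2 / r) 1 with h2 | h2
  · rw [← arccos_sin_tilt hq]
    exact Real.arccos_lt_arccos (by linarith [sin_tilt_pos hq]) h1 h2
  · rw [Real.arccos_of_one_le h2.le]
    exact halfAngle_pos hq

lemma radialFactor_nonneg {q : ℕ} (hq : 1 < q) (w r : ℝ) : 0 ≤ radialFactor q w r := by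
  have h1 := halfAngle_pos hq
  have h2 := Real.pi_pos
  have h3 := chordAngle_nonneg q w r
  refine mul_nonneg two_pos.le (Real.cos_nonneg_of_mem_Icc ⟨?_, ?_⟩)
  · have : 0 ≤ Real.pi * chordAngle q w r / (2 * halfAngle q) := by positivity
    linarith
  · rw [div_le_div_iff₀ (by positivity) two_pos]
    nlinarith [chordAngle_le hq w r]

lemma radialFactor_pos {q : ℕ} (hq : 1 < q) {w r : ℝ} (hr : 0 < r)
    (h : r < circumradius q w) : 0 < radialFactor q w r := by
  have h1 := halfAngle_pos hq
  have h2 := Real.pi_pos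
  have h3 := chordAngle_nonneg q w r
  refine mul_pos two_pos (Real.cos_pos_of_mem_Ioo ⟨?_, ?_⟩)
  · have : 0 ≤ Real.pi * chordAngle q w r / (2 * halfAngle q) := by positivity
    linarith
  · rw [div_lt_div_iff₀ (by positivity) two_pos]
    nlinarith [chordAngle_lt hq hr h]

lemma radialFactor_of_circumradius_le {q : ℕ} (hq : 1 < q) {w r : ℝ} (hr : 0 < r)
    (h : circumradius q w ≤ r) : radialFactor q w r = 0 := by
  have h1 := (halfAngle_pos hq).ne'
  rw [radialFactor, chordAngle_of_circumradius_le hq hr h,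
    show Real.pi * halfAngle q / (2 * halfAngle q) = Real.pi / 2 by field_simp,
    Real.cos_pi_div_two, mul_zero]

/-- From the radius ρ on, the square root is frozen at ρ cos ε, half the length of an edge. What
remains is the signed distance to the tangent on the side of `ζ`. -/
lemma creaseGap_of_circumradius_le {q : ℕ} (hq : 1 < q) {w : ℝ} (hw : 0 < w) {ζ : ℂ}
    (h : circumradius q w ≤ ‖ζ‖) : creaseGap q w ζ =
      circumradius q w - |ζ.im| * Real.cos (tilt q) - ζ.re * Real.sin (tilt q) := by
  have h1 : circumradius q w ^ 2 - (w / 2) ^ 2 = (circumradius q w * Real.cos (tilt q)) ^ 2 := by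
    rw [← circumradius_mul_sin hq w, mul_pow, mul_pow, Real.cos_sq']
    ring
  rw [creaseGap, min_eq_right h, h1,
    Real.sqrt_sq (mul_pos (circumradius_pos hq hw) (cos_tilt_pos hq)).le,
    ← circumradius_mul_sin hq w]
  linear_combination circumradius q w * Real.sin_sq_add_cos_sq (tilt q)

lemma sin_four_mul_tilt_pos {q : ℕ} (hq : 1 < q) : 0 < Real.sin (4 * tilt q) :=
  Real.sin_pos_of_pos_of_lt_pi (by linarith [tilt_pos q]) (by linarith [tilt_lt hq, tilt_pos q])

/-- The quotient of the two sides is 2 cos ε cos 2ε, and both angles are below π/4. It makes w / sin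
4ε smaller than ρ; this fails for q = 1. -/
lemma two_mul_sin_tilt_lt {q : ℕ} (hq : 1 < q) :
    2 * Real.sin (tilt q) < Real.sin (4 * tilt q) := by
  have h1 : Real.sin (4 * tilt q) =
      2 * Real.sin (tilt q) * (2 * (Real.cos (tilt q) * Real.cos (2 * tilt q))) := by
    rw [show 4 * tilt q = 2 * (2 * tilt q) by ring, Real.sin_two_mul, Real.sin_two_mul]
    ring
  have h2 : ∀ x, 0 < x → 9 * x < 2 * Real.pi → Real.sqrt 2 / 2 < Real.cos x := fun x h3 h4 => by
    rw [← Real.cos_pi_div_four]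
    exact Real.cos_lt_cos_of_nonneg_of_le_pi h3.le (by linarith [Real.pi_pos])
      (by linarith [Real.pi_pos])
  have h3 := h2 _ (tilt_pos q) (by linarith [tilt_lt hq, Real.pi_pos])
  have h4 := h2 (2 * tilt q) (by linarith [tilt_pos q]) (by linarith [tilt_lt hq])
  have h5 : 0 < Real.sqrt 2 / 2 := by positivity
  have h6 := mul_lt_mul'' h3 h4 h5.le h5.le
  have h7 : Real.sqrt 2 / 2 * (Real.sqrt 2 / 2) = 1 / 2 := by
    have := Real.mul_self_sqrt (zero_le_two (α := ℝ))
    linarith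
  rw [h1]
  nlinarith [sin_tilt_pos hq]

lemma div_sin_lt_circumradius {q : ℕ} (hq : 1 < q) {w : ℝ} (hw : 0 < w) :
    w / Real.sin (4 * tilt q) < circumradius q w := by
  rw [circumradius, div_div]
  exact div_lt_div_of_pos_left hw (mul_pos two_pos (sin_tilt_pos hq)) (two_mul_sin_tilt_lt hq)

lemma lt_circumradius {q : ℕ} (hq : 1 < q) {w : ℝ} (hw : 0 < w) : w < circumradius q w := by
  refine lt_of_le_of_lt ?_ (div_sin_lt_circumradius hq hw)
  rw [le_div_iff₀ (sin_four_mul_tilt_pos hq)]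
  nlinarith [Real.sin_le_one (4 * tilt q)]

lemma creaseFactor_nonneg {q : ℕ} (hq : 1 < q) (w : ℝ) (ζ : ℂ) : 0 ≤ creaseFactor q w ζ :=
  add_nonneg (radialFactor_nonneg hq _ _) (mul_nonneg (le_max_left _ _) (abs_nonneg _))

/-- Inside the circumscribed circle the radial summand is positive. From the circle on it is 0, and
the weight of `creaseGap` is positive because w / sin 4ε < ρ. -/
lemma creaseFactor_eq_zero_iff {q : ℕ} (hq : 1 < q) {w : ℝ} (hw : 0 < w) {ζ : ℂ} (hζ : 0 < ‖ζ‖) :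
    creaseFactor q w ζ = 0 ↔ circumradius q w ≤ ‖ζ‖ ∧
      circumradius q w = |ζ.im| * Real.cos (tilt q) + ζ.re * Real.sin (tilt q) := by
  have h2 : 0 ≤ max 0 (‖ζ‖ - w / Real.sin (4 * tilt q)) * |creaseGap q w ζ| :=
    mul_nonneg (le_max_left _ _) (abs_nonneg _)
  rcases lt_or_ge ‖ζ‖ (circumradius q w) with h | h
  · have h1 := radialFactor_pos hq hζ h
    refine iff_of_false ?_ fun h3 => absurd h3.1 h.not_ge
    rw [creaseFactor]
    positivity
  · have h3 := div_sin_lt_circumradius hq hw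
    rw [creaseFactor, radialFactor_of_circumradius_le hq hζ h, zero_add,
      max_eq_right (by linarith), mul_eq_zero, or_iff_right (by linarith), abs_eq_zero,
      creaseGap_of_circumradius_le hq hw h]
    constructor
    · intro h4; exact ⟨h, by linarith⟩
    · intro h4; linarith [h4.2]

lemma creaseFactor_of_le {q : ℕ} {w : ℝ} {ζ : ℂ} (h : ‖ζ‖ ≤ w / Real.sin (4 * tilt q)) :
    creaseFactor q w ζ = radialFactor q w ‖ζ‖ := by
  rw [creaseFactor, max_eq_left (by linarith), zero_mul, add_zero]

lemma angleFactor_pos {q : ℕ} (hq : 1 < q) {θ : ℝ} (h0 : 0 < θ) (h1 : θ < Real.pi / 2) :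
    0 < Real.sin (Real.pi * θ / (2 * halfAngle q)) := by
  have h2 := halfAngle_pos hq
  have h3 := Real.pi_pos
  refine Real.sin_pos_of_pos_of_lt_pi (by positivity) ?_
  rw [div_lt_iff₀ (by positivity)]
  have := halfAngle_add_tilt q
  have := tilt_lt hq
  nlinarith

lemma angleFactor_neg (q : ℕ) (θ : ℝ) : Real.sin (Real.pi * (-θ) / (2 * halfAngle q)) =
    -Real.sin (Real.pi * θ / (2 * halfAngle q)) := by
  rw [← Real.sin_neg]; congr 1; ring

/-- The angles may exceed β, where the sine starts to decrease, but a gap of 4ε keeps their sum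
below π - 4ε < 2β. Both factors in the difference of sines are then positive. -/
lemma angleFactor_ne {q : ℕ} (hq : 1 < q) {θ θ' : ℝ} (h0 : 0 < θ') (h1 : θ < Real.pi / 2)
    (h2 : θ' + 4 * tilt q ≤ θ) : Real.sin (Real.pi * θ / (2 * halfAngle q)) ≠
      Real.sin (Real.pi * θ' / (2 * halfAngle q)) := by
  have h3 := halfAngle_pos hq
  have h4 := Real.pi_pos
  have h5 := tilt_pos q
  have h6 := halfAngle_add_tilt q
  have h7 := tilt_lt hq
  have e : Real.sin (Real.pi * θ / (2 * halfAngle q)) - Real.sin (Real.pi * θ' / (2 * halfAngle q))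
      = 2 * Real.sin (Real.pi * (θ - θ') / (4 * halfAngle q)) *
        Real.cos (Real.pi * (θ + θ') / (4 * halfAngle q)) := by
    rw [Real.sin_sub_sin]
    congr 2
    · congr 1; field_simp; ring
    · field_simp; ring
  refine ne_of_gt (sub_pos.1 ?_)
  rw [e]
  refine mul_pos (mul_pos two_pos (Real.sin_pos_of_pos_of_lt_pi ?_ ?_))
    (Real.cos_pos_of_mem_Ioo ⟨?_, ?_⟩)
  · exact div_pos (mul_pos h4 (by linarith)) (by linarith)
  · rw [div_lt_iff₀ (by positivity)]; nlinarith
  · exact lt_trans (by linarith) (div_pos (mul_pos h4 (by linarith : 0 < θ + θ')) (by linarith))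
  · rw [div_lt_div_iff₀ (by positivity) two_pos]
    nlinarith

/-- Where two sheets differing by a rotation overlap on the same side, the radius is small. -/
lemma norm_lt_of_overlap {q : ℕ} (hq : 1 < q) {w r θ : ℝ} (hr : 0 < r)
    (hθ : |θ| + 4 * tilt q < Real.pi / 2) (h : r * Real.cos θ < w) :
    r < w / Real.sin (4 * tilt q) := by
  rw [lt_div_iff₀ (sin_four_mul_tilt_pos hq)]
  refine lt_of_le_of_lt (mul_le_mul_of_nonneg_left ?_ hr.le) h
  rw [← Real.cos_abs θ, ← Real.cos_pi_div_two_sub]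
  have := tilt_pos q
  exact Real.cos_le_cos_of_nonneg_of_le_pi (abs_nonneg θ) (by linarith [Real.pi_pos])
    (by linarith)

lemma abs_arg_lt_of_mem_openSheet {q : ℕ} {w : ℝ} {ζ : ℂ} (hζ : ζ ∈ openSheet q w) :
    |ζ.arg| < Real.pi / 2 :=
  Complex.abs_arg_lt_pi_div_two_iff.2 (Or.inl hζ.1.1)

lemma norm_pos_of_mem_openSheet {q : ℕ} {w : ℝ} {ζ : ℂ} (hζ : ζ ∈ openSheet q w) : 0 < ‖ζ‖ :=
  hζ.1.1.trans_le (Complex.re_le_norm ζ)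

/-- Points of two rotated sheets on the two fold lines differ by the rotation between successive
pieces. -/
lemma eq_of_crease {q : ℕ} (hq : 1 < q) {w r θ θ' : ℝ} {m : ℤ} (hr : 0 < r)
    (hθ : 0 < θ) (hθ1 : θ < Real.pi / 2) (hθ' : θ' < 0) (hθ1' : -(Real.pi / 2) < θ')
    (hm : θ - θ' = 4 * tilt q * m) (hw : r * Real.cos θ < w)
    (h : r * Real.cos (θ - halfAngle q) = circumradius q w)
    (h' : r * Real.cos (θ' + halfAngle q) = circumradius q w) : m = q := by
  have h1 := tilt_pos q
  have h2 := halfAngle_add_tilt q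
  have h3 := tilt_lt hq
  -- Two tangents meet the circle of radius r at points equally far in angle from their points of
  -- contact.
  have h4 : |θ - halfAngle q| = |θ' + halfAngle q| := by
    refine Real.injOn_cos ⟨abs_nonneg _, ?_⟩ ⟨abs_nonneg _, ?_⟩ ?_
    · rw [abs_le]; constructor <;> linarith
    · rw [abs_le]; constructor <;> linarith
    · rw [Real.cos_abs, Real.cos_abs]
      exact mul_left_cancel₀ hr.ne' (h.trans h'.symm)
  rcases abs_eq_abs.1 h4 with h5 | h5
  · have h6 : 4 * tilt q * m = 4 * tilt q * q := by
      rw [← hm]; unfold halfAngle at h5; linarith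
    exact_mod_cast mul_left_cancel₀ (by positivity) h6
  -- The symmetric case θ' = -θ. Rewriting w = 2r cos(θ - β) cos β as a sum of cosines, re < w
  -- forces 2β - θ < π/2. So 2m lies strictly between 2q - 1 and 2q + 1.
  · have h6 : θ = 2 * tilt q * m := by linarith
    have h7 : 0 < Real.cos (2 * halfAngle q - θ) := by
      have h8 : w = r * (Real.cos θ + Real.cos (2 * halfAngle q - θ)) := by
        rw [← Real.cos_neg (2 * halfAngle q - θ), Real.cos_add_cos,
          show (θ + -(2 * halfAngle q - θ)) / 2 = θ - halfAngle q by ring,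
          show (θ - -(2 * halfAngle q - θ)) / 2 = halfAngle q by ring, cos_halfAngle]
        linear_combination -2 * Real.sin (tilt q) * h - 2 * circumradius_mul_sin hq w
      by_contra h9
      nlinarith
    have h8 : 2 * halfAngle q - θ < Real.pi / 2 := by
      by_contra h9
      exact h7.not_ge (Real.cos_nonpos_of_pi_div_two_le_of_le (not_lt.1 h9) (by linarith))
    have h9 := two_mul_add_one_mul_tilt q
    have h10 : (2 * q - 1) * tilt q < 2 * m * tilt q := by unfold halfAngle at *; linarith
    have h11 : 2 * m * tilt q < (2 * q + 1) * tilt q := by linarith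
    have h12 : (2 * q - 1 : ℤ) < 2 * m := by exact_mod_cast lt_of_mul_lt_mul_right h10 h1.le
    have h13 : (2 * m : ℤ) < 2 * q + 1 := by exact_mod_cast lt_of_mul_lt_mul_right h11 h1.le
    omega

/-- Angles of one sign are told apart by the angular factor; for angles of opposite signs the
heights have opposite weak signs, so equality puts both points on fold lines. The value m = q means
successive pieces. -/
lemma sheetHeight_eq_imp {q : ℕ} (hq : 1 < q) {w : ℝ} (hw : 0 < w) {ζ ζ' : ℂ}
    (hζ : ζ ∈ openSheet q w) (hζ' : ζ' ∈ openSheet q w) (hn : ‖ζ‖ = ‖ζ'‖) {m : ℤ} (hm : 0 < m)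
    (harg : ζ.arg - ζ'.arg = 4 * tilt q * m) (h : sheetHeight q w ζ = sheetHeight q w ζ') :
    m = q ∧ ζ'.re * Real.sin (tilt q) - ζ'.im * Real.cos (tilt q) = circumradius q w := by
  have hθ := abs_lt.1 (abs_arg_lt_of_mem_openSheet hζ)
  have hθ' := abs_lt.1 (abs_arg_lt_of_mem_openSheet hζ')
  have hr := norm_pos_of_mem_openSheet hζ
  have hr' := norm_pos_of_mem_openSheet hζ'
  have hε := tilt_pos q
  have hm1 : (1 : ℝ) ≤ m := by exact_mod_cast hm
  have hstep : ζ'.arg + 4 * tilt q ≤ ζ.arg := by nlinarith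
  have hre := Complex.norm_mul_cos_arg ζ
  have hre' := Complex.norm_mul_cos_arg ζ'
  have him := Complex.norm_mul_sin_arg ζ
  have him' := Complex.norm_mul_sin_arg ζ'
  -- Within this radius both heights have the same positive radial factor, which cancels.
  have key : ‖ζ‖ < w / Real.sin (4 * tilt q) →
      Real.sin (Real.pi * ζ.arg / (2 * halfAngle q)) =
        Real.sin (Real.pi * ζ'.arg / (2 * halfAngle q)) := fun hlt => by
    have h1 := radialFactor_pos hq hr (hlt.trans (div_sin_lt_circumradius hq hw))
    rw [sheetHeight, sheetHeight, creaseFactor_of_le hlt.le, creaseFactor_of_le (hn ▸ hlt.le),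
      ← hn] at h
    exact mul_right_cancel₀ h1.ne' h
  rcases lt_or_ge 0 ζ'.arg with h0' | h0'
  · refine absurd (key ?_) (angleFactor_ne hq h0' hθ.2 hstep)
    rw [hn]
    refine norm_lt_of_overlap hq hr' ?_ (hre'.trans_lt hζ'.1.2)
    rw [abs_of_pos h0']; linarith
  rcases lt_or_ge ζ.arg 0 with h0 | h0
  · have h1 := angleFactor_ne hq (θ := -ζ'.arg) (θ' := -ζ.arg) (by linarith) (by linarith)
      (by linarith)
    rw [angleFactor_neg, angleFactor_neg] at h1
    refine absurd (congrArg Neg.neg (key ?_).symm) h1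
    refine norm_lt_of_overlap hq hr ?_ (hre.trans_lt hζ.1.2)
    rw [abs_of_neg h0]; linarith
  have hG := creaseFactor_nonneg hq w ζ
  have hG' := creaseFactor_nonneg hq w ζ'
  have hF : 0 < ζ.arg → 0 < Real.sin (Real.pi * ζ.arg / (2 * halfAngle q)) :=
    fun h1 => angleFactor_pos hq h1 hθ.2
  have hF' : ζ'.arg < 0 → Real.sin (Real.pi * ζ'.arg / (2 * halfAngle q)) < 0 := fun h1 => by
    have := angleFactor_pos hq (θ := -ζ'.arg) (by linarith) (by linarith)
    rw [angleFactor_neg] at this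
    linarith
  -- At angle 0 the norm equals the real part and is below w < ρ, so no zero of `creaseFactor` has
  -- this radius. This excludes angle 0 for either point.
  have hwr := lt_circumradius hq hw
  rw [sheetHeight, sheetHeight] at h
  have hpos : 0 < ζ.arg := by
    refine lt_of_le_of_ne h0 fun h1 => ?_
    have h2 := hF' (by linarith)
    rw [← h1, mul_zero, zero_div, Real.sin_zero, zero_mul, eq_comm, mul_eq_zero,
      or_iff_right h2.ne, creaseFactor_eq_zero_iff hq hw hr', ← hn] at h
    rw [← h1, Real.cos_zero] at hre
    linarith [h.1, hζ.1.2]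
  have hneg : ζ'.arg < 0 := by
    refine lt_of_le_of_ne h0' fun h1 => ?_
    rw [h1, mul_zero, zero_div, Real.sin_zero, zero_mul, mul_eq_zero,
      or_iff_right (hF hpos).ne', creaseFactor_eq_zero_iff hq hw hr, hn] at h
    rw [h1, Real.cos_zero] at hre'
    linarith [h.1, hζ'.1.2]
  have hF := hF hpos
  have hF' := hF' hneg
  have hz : creaseFactor q w ζ = 0 := by
    by_contra h1
    have := mul_pos hF (lt_of_le_of_ne hG (Ne.symm h1))
    nlinarith
  have hz' : creaseFactor q w ζ' = 0 := by
    by_contra h1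
    have := mul_pos (neg_pos.2 hF') (lt_of_le_of_ne hG' (Ne.symm h1))
    nlinarith
  have hz := ((creaseFactor_eq_zero_iff hq hw hr).1 hz).2
  have hz' := ((creaseFactor_eq_zero_iff hq hw hr').1 hz').2
  have hs : 0 < Real.sin ζ.arg := Real.sin_pos_of_pos_of_lt_pi hpos
    (by linarith [Real.pi_pos])
  have hs' : Real.sin ζ'.arg < 0 := Real.sin_neg_of_neg_of_neg_pi_lt hneg
    (by linarith [Real.pi_pos])
  rw [abs_of_nonneg (by rw [← him]; positivity)] at hz
  rw [abs_of_nonpos (by rw [← him']; nlinarith)] at hz'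
  refine ⟨eq_of_crease hq hr hpos hθ.2 hneg hθ'.1 harg (hre.trans_lt hζ.1.2) ?_ ?_, by linarith⟩
  · rw [Real.cos_sub, cos_halfAngle, sin_halfAngle, hz]
    linear_combination Real.sin (tilt q) * hre + Real.cos (tilt q) * him
  · rw [Real.cos_add, cos_halfAngle, sin_halfAngle, hz', hn]
    linear_combination Real.sin (tilt q) * hre' - Real.cos (tilt q) * him'

lemma continuousOn_sheetHeight (q : ℕ) (w : ℝ) :
    ContinuousOn (sheetHeight q w) {ζ | 0 < ζ.re} := by
  have h1 : ContinuousOn Complex.arg {ζ : ℂ | 0 < ζ.re} := fun ζ hζ =>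
    (Complex.continuousAt_arg (Or.inl hζ)).continuousWithinAt
  have h2 : ContinuousOn (fun ζ : ℂ => w / 2 / ‖ζ‖) {ζ : ℂ | 0 < ζ.re} :=
    continuousOn_const.div continuous_norm.continuousOn fun ζ hζ =>
      (lt_of_lt_of_le hζ (Complex.re_le_norm ζ)).ne'
  have h3 : ContinuousOn (fun ζ : ℂ => chordAngle q w ‖ζ‖) {ζ : ℂ | 0 < ζ.re} :=
    Real.continuous_arccos.comp_continuousOn (h2.sup continuousOn_const)
  have h4 : ContinuousOn (fun ζ : ℂ => radialFactor q w ‖ζ‖) {ζ : ℂ | 0 < ζ.re} := by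
    unfold radialFactor
    exact continuousOn_const.mul (Real.continuous_cos.comp_continuousOn
      ((continuousOn_const.mul h3).div_const _))
  have h5 : Continuous (creaseGap q w) := by
    unfold creaseGap
    fun_prop
  have h6 : ContinuousOn (creaseFactor q w) {ζ : ℂ | 0 < ζ.re} := by
    unfold creaseFactor
    exact h4.add (by fun_prop)
  unfold sheetHeight
  exact (Real.continuous_sin.comp_continuousOn ((continuousOn_const.mul h1).div_const _)).mul h6

/-- Cauchy–Schwarz with the unit vector (sin ε, cos ε): a tangent stays outside its circle. -/
lemma le_norm_of_crease {q : ℕ} {ρ : ℝ} {ζ : ℂ}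
    (h : ζ.re * Real.sin (tilt q) + |ζ.im| * Real.cos (tilt q) = ρ) : ρ ≤ ‖ζ‖ := by
  refine le_of_sq_le_sq ?_ (norm_nonneg ζ)
  rw [← Complex.normSq_eq_norm_sq, Complex.normSq_apply, ← h, ← abs_mul_abs_self ζ.im]
  nlinarith [Real.sin_sq_add_cos_sq (tilt q),
    sq_nonneg (ζ.re * Real.cos (tilt q) - |ζ.im| * Real.sin (tilt q))]

lemma sheetHeight_of_crease {q : ℕ} (hq : 1 < q) {w : ℝ} (hw : 0 < w) {ζ : ℂ}
    (h0 : 0 < ζ.re) (h : ζ.re * Real.sin (tilt q) + |ζ.im| * Real.cos (tilt q) =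
      circumradius q w) : sheetHeight q w ζ = 0 := by
  have hr : 0 < ‖ζ‖ := h0.trans_le (Complex.re_le_norm ζ)
  rw [sheetHeight, (creaseFactor_eq_zero_iff hq hw hr).2 ⟨le_norm_of_crease h, by linarith⟩,
    mul_zero]

/-- Here w sin ε = 2ρ sin² ε < ρ. Hence a fold line does not meet the axis of its piece, which
separates the two folds and fixes the sign of the imaginary part on each. -/
lemma mul_sin_lt_circumradius {q : ℕ} (hq : 1 < q) {w x : ℝ} (hw : 0 < w) (hx : x ≤ w) :
    x * Real.sin (tilt q) < circumradius q w := by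
  have h1 := circumradius_mul_sin hq w
  have h2 := two_mul_sin_tilt_sq_lt hq
  have h3 := circumradius_pos hq hw
  have h4 := sin_tilt_pos hq
  calc x * Real.sin (tilt q) ≤ w * Real.sin (tilt q) := by gcongr
    _ = circumradius q w * (2 * Real.sin (tilt q) ^ 2) := by
      linear_combination -2 * Real.sin (tilt q) * h1
    _ < circumradius q w := by nlinarith

/-! ### The star ribbon is flat folded, and its length -/

section FlatFolded

variable {q : ℕ} (hq : 1 < q) {w : ℝ} (hw : 0 < w)

lemma natCoprime_two_mul_add_one (q : ℕ) : q.Coprime (2 * q + 1) := by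
  simp

lemma isUnit_natCast_zmod (q : ℕ) : IsUnit (q : ZMod (2 * q + 1)) := by
  rw [ZMod.isUnit_iff_coprime]
  exact natCoprime_two_mul_add_one q

/-- The frames of two pieces differ by a rotation through a multiple of `4 * tilt q`. -/
lemma exists_arg_frame_sub (i j : ZMod (2 * q + 1)) {z : ℂ} (hz : z ≠ 0) : ∃ m : ℤ,
    (frame q i z).arg - (frame q j z).arg = 4 * tilt q * m ∧ (m : ZMod (2 * q + 1)) = q * (j - i) := by
  have hr : (‖z‖ : ℂ) ≠ 0 := by exact_mod_cast norm_ne_zero_iff.2 hz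
  obtain ⟨k, hk⟩ := ZMod.intCast_surjective (j - i)
  have h1 : frame q i z = frame q j z * vertexDir q (j - i) := by
    have h2 : vertexDir q j = vertexDir q i * vertexDir q (j - i) := by
      rw [← vertexDir_add, add_sub_cancel]
    rw [frame, frame, edgeDir, edgeDir, h2]
    simp only [map_mul]
    linear_combination -z * (starRingEnd ℂ) (vertexDir q i) * (starRingEnd ℂ) (halfTurn q) *
      vertexDir_mul_conj q (j - i)
  rw [← hk, vertexDir_intCast, ← Complex.norm_mul_exp_arg_mul_I (frame q i z),
    ← Complex.norm_mul_exp_arg_mul_I (frame q j z), norm_frame, norm_frame, mul_assoc,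
    ← Complex.exp_add] at h1
  obtain ⟨l, hl⟩ := Complex.exp_eq_exp_iff_exists_int.1 (mul_left_cancel₀ hr h1)
  -- Going k pieces on turns by 2βk = 4εqk, and a full turn is 4εn; l corrects the branch of `arg`.
  refine ⟨q * k + (2 * q + 1) * l, ?_, ?_⟩
  · have h3 : ((frame q i z).arg : ℂ) = ((frame q j z).arg + 2 * halfAngle q * k +
        l * (2 * Real.pi) : ℝ) := by
      refine mul_right_cancel₀ Complex.I_ne_zero ?_
      rw [hl]
      push_cast
      ring
    have h4 := two_mul_add_one_mul_tilt q
    rw [Complex.ofReal_inj.1 h3, halfAngle]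
    push_cast
    linear_combination -4 * l * h4
  · rw [← hk]
    have h5 : ((2 * q + 1 : ℕ) : ZMod (2 * q + 1)) = 0 := ZMod.natCast_self _
    push_cast at h5 ⊢
    linear_combination l * h5

include hq hw in
lemma norm_starRibbon_edge_pos (h : ℂ → ℝ) (i : ZMod (2 * q + 1)) :
    0 < ‖(starRibbon q w h).vertex (i + 1) - (starRibbon q w h).vertex i‖ := by
  rw [norm_starRibbon_edge hq hw]
  exact mul_pos (mul_pos two_pos (circumradius_pos hq hw)) (cos_tilt_pos hq)

include hq in
/-- On a fold line, the coordinates in the frames of the two adjacent pieces. -/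
lemma frame_sub_one_of_crease {i : ZMod (2 * q + 1)} {z : ℂ}
    (h : (frame q i z).re * Real.sin (tilt q) - (frame q i z).im * Real.cos (tilt q) =
      circumradius q w) :
    (frame q (i - 1) z).re * Real.sin (tilt q) + (frame q (i - 1) z).im * Real.cos (tilt q) =
      circumradius q w ∧ (frame q (i - 1) z).re = w - (frame q i z).re := by
  have h1 := frame_crease i z
  have h2 := congrArg Complex.re h1
  have h3 := congrArg Complex.im h1
  rw [frame_mul_halfTurn_re, frame_mul_conj_halfTurn_re, h] at h2
  simp only [Complex.mul_im, Complex.conj_re, Complex.conj_im, halfTurn_re, halfTurn_im] at h3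
  refine ⟨h2.symm, ?_⟩
  have h4 := circumradius_mul_sin hq w
  have h5 := Real.sin_sq_add_cos_sq (tilt q)
  linear_combination -Real.sin (tilt q) * h2 + Real.cos (tilt q) * h3 + 2 * h4 +
    Real.sin (tilt q) * h - ((frame q (i - 1) z).re + (frame q i z).re) * h5

include hq hw in
theorem starRibbon_isFlatFolded : (starRibbon q w (sheetHeight q w)).IsFlatFolded where
  width_pos := hw
  edge_ne i h := by
    have h1 := norm_starRibbon_edge_pos hq hw (sheetHeight q w) i
    rw [h, sub_self, norm_zero] at h1
    exact h1.false
  fold i h := by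
    have h1 := starRibbon_dir_sub hq hw (sheetHeight q w) i
    rw [h, sub_self, eq_comm, mul_eq_zero, Complex.ofReal_eq_zero, neg_eq_zero] at h1
    rcases h1 with h1 | h1
    · linarith [cos_tilt_pos hq]
    · have := vertexDir_mul_conj q i
      rw [h1, zero_mul] at this
      exact zero_ne_one this
  crease_disjoint i := by
    rw [Set.disjoint_left]
    intro z h1 h2
    rw [mem_starRibbon_crease hq hw] at h1 h2
    have h3 := (frame_sub_one_of_crease hq h2.1).1
    rw [add_sub_cancel_right] at h3
    linarith [mul_sin_lt_circumradius hq hw h1.2.2, h1.1]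
  height_continuous i := by
    refine (continuousOn_sheetHeight q w).comp (Continuous.continuousOn ?_) fun z hz =>
      ((mem_starRibbon_openPiece hq hw _ i z).1 hz).1.1
    exact continuous_id.mul continuous_const
  height_crease i z hz hz' := by
    rw [mem_starRibbon_crease hq hw] at hz
    rw [starRibbon_abs_offset_lt hq hw] at hz'
    have h1 := frame_sub_one_of_crease hq hz.1
    have h2 := cos_tilt_pos hq
    change sheetHeight q w _ = sheetHeight q w _
    rw [sheetHeight_of_crease hq hw hz'.1, sheetHeight_of_crease hq hw (by linarith [h1.2])]
    · have : 0 < (frame q (i - 1) z).im := by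
        have := mul_sin_lt_circumradius hq hw
          (show (frame q (i - 1) z).re ≤ w by linarith [h1.2])
        nlinarith [h1.1]
      rw [abs_of_pos this, h1.1]
    · have : (frame q i z).im < 0 := by
        have := mul_sin_lt_circumradius hq hw hz.2.2
        nlinarith [hz.1]
      rw [abs_of_neg this, ← hz.1]
      ring
  height_injective i j z hi hj h := by
    rw [mem_starRibbon_openPiece hq hw] at hi hj
    have hz : z ≠ 0 := by
      rintro rfl
      simpa [frame] using hi.1.1
    have hu : IsUnit (q : ZMod (2 * q + 1)) := isUnit_natCast_zmod q
    obtain ⟨m, hm, hm'⟩ := exists_arg_frame_sub i j hz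
    have hn : ‖frame q i z‖ = ‖frame q j z‖ := by rw [norm_frame, norm_frame]
    rcases lt_trichotomy m 0 with h0 | h0 | h0
    · right; right
      obtain ⟨h1, h2⟩ := sheetHeight_eq_imp hq hw hj hi hn.symm (neg_pos.2 h0)
        (by push_cast; linarith) h.symm
      refine ⟨?_, (mem_starRibbon_crease hq hw _ i z).2 ⟨h2, hi.1.1.le, hi.1.2.le⟩⟩
      -- The rotation number is q times the index difference, and q is a unit mod n, so a rotation
      -- number q means an index difference 1.
      have h3 : (q : ZMod (2 * q + 1)) * (i - j) = q * 1 := by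
        rw [← neg_sub j i, mul_neg, ← hm', ← Int.cast_neg, h1, mul_one, Int.cast_natCast]
      rw [← hu.mul_left_cancel h3]
      ring
    · left
      rw [h0, Int.cast_zero, eq_comm, ← mul_zero (q : ZMod (2 * q + 1))] at hm'
      exact (sub_eq_zero.1 (hu.mul_left_cancel hm')).symm
    · right; left
      obtain ⟨h1, h2⟩ := sheetHeight_eq_imp hq hw hi hj hn h0 hm h
      refine ⟨?_, (mem_starRibbon_crease hq hw _ j z).2 ⟨h2, hj.1.1.le, hj.1.2.le⟩⟩
      have h3 : (q : ZMod (2 * q + 1)) * (j - i) = q * 1 := by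
        rw [← hm', h1, mul_one, Int.cast_natCast]
      rw [← hu.mul_left_cancel h3]
      ring

include hq hw in
theorem starRibbon_length (h : ℂ → ℝ) : (starRibbon q w h).length / (starRibbon q w h).width =
    (2 * q + 1) * Real.cot (Real.pi / (2 * (2 * q + 1))) := by
  have h1 : ∀ i, dist ((starRibbon q w h).vertex i) ((starRibbon q w h).vertex (i + 1)) =
      2 * circumradius q w * Real.cos (tilt q) := fun i => by
    rw [dist_comm, dist_eq_norm, norm_starRibbon_edge hq hw]
  have h2 := sin_tilt_pos hq
  change _ / w = (2 * q + 1) * Real.cot (tilt q)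
  rw [ClosedRibbon.length, Finset.sum_congr rfl fun i _ => h1 i, Finset.sum_const,
    Finset.card_univ, ZMod.card, nsmul_eq_mul, Real.cot_eq_cos_div_sin, circumradius]
  push_cast
  field_simp

end FlatFolded

/-! ### The pieces as a pinwheel of trapezoids -/

/-- The half-width at height im interpolates linearly between b/2 and t/2; the inequality is
multiplied by w. -/
lemma mem_isoTrapezoid {b t w : ℝ} (hb : 0 < b) (ht : 0 < t) (hw : 0 < w) (z : ℂ) :
    z ∈ isoTrapezoid b t w ↔
      (0 ≤ z.im ∧ z.im ≤ w) ∧ w * |z.re| ≤ (w - z.im) * (b / 2) + z.im * (t / 2) := by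
  constructor
  · refine fun hz => convexHull_min (t := {z : ℂ | (0 ≤ z.im ∧ z.im ≤ w) ∧
      w * |z.re| ≤ (w - z.im) * (b / 2) + z.im * (t / 2)}) ?_ ?_ hz
    · rintro z (rfl | rfl | rfl | rfl)
      · refine ⟨⟨le_rfl, hw.le⟩, ?_⟩
        rw [abs_of_nonpos (by simp only; linarith)]
        simp only
        linarith
      · refine ⟨⟨le_rfl, hw.le⟩, ?_⟩
        rw [abs_of_nonneg (by simp only; linarith)]
        simp only
        linarith
      · refine ⟨⟨hw.le, le_rfl⟩, ?_⟩
        rw [abs_of_nonneg (by simp only; linarith)]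
        simp only
        linarith
      · refine ⟨⟨hw.le, le_rfl⟩, ?_⟩
        rw [abs_of_nonpos (by simp only; linarith)]
        simp only
        linarith
    · rintro x ⟨⟨h1, h2⟩, h3⟩ y ⟨⟨h4, h5⟩, h6⟩ α β hα hβ hαβ
      have e1 : (α • x + β • y).re = α * x.re + β * y.re := by simp
      have e2 : (α • x + β • y).im = α * x.im + β * y.im := by simp
      change (0 ≤ (α • x + β • y).im ∧ _ ≤ w) ∧ w * |_| ≤ _
      rw [e1, e2]
      obtain rfl : β = 1 - α := by linarith
      refine ⟨⟨by positivity, by nlinarith⟩, ?_⟩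
      have h7 : |α * x.re + (1 - α) * y.re| ≤ α * |x.re| + (1 - α) * |y.re| := by
        refine (abs_add_le _ _).trans_eq ?_
        rw [abs_mul, abs_mul, abs_of_nonneg hα, abs_of_nonneg hβ]
      have h8 := mul_le_mul_of_nonneg_left h7 hw.le
      have h9 := mul_le_mul_of_nonneg_left h3 hα
      have h10 := mul_le_mul_of_nonneg_left h6 hβ
      linarith
  · rintro ⟨⟨h1, h2⟩, h3⟩
    set L := ((w - z.im) * (b / 2) + z.im * (t / 2)) / w with hL
    have hL0 : 0 < L := by
      refine div_pos ?_ hw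
      rcases h1.eq_or_lt with h | h
      · rw [← h]; simpa using mul_pos hw (half_pos hb)
      · exact add_pos_of_nonneg_of_pos (mul_nonneg (by linarith) (by linarith)) (by positivity)
    have hx : |z.re| ≤ L := by rw [hL, le_div_iff₀ hw]; linarith
    obtain ⟨hx1, hx2⟩ := abs_le.1 hx
    have hs1 : 0 ≤ (1 - z.re / L) / 2 := by
      have : z.re / L ≤ 1 := (div_le_one hL0).2 hx2
      linarith
    have hs2 : 0 ≤ (1 + z.re / L) / 2 := by
      have : -1 ≤ z.re / L := (le_div_iff₀ hL0).2 (by linarith)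
      linarith
    have hy : 0 ≤ 1 - z.im / w := sub_nonneg.2 ((div_le_one hw).2 h2)
    have hy' : 0 ≤ z.im / w := div_nonneg h1 hw.le
    have hc := convex_convexHull ℝ ({(⟨-b / 2, 0⟩ : ℂ), ⟨b / 2, 0⟩, ⟨t / 2, w⟩, ⟨-t / 2, w⟩} : Set ℂ)
    have hsub := subset_convexHull ℝ
      ({(⟨-b / 2, 0⟩ : ℂ), ⟨b / 2, 0⟩, ⟨t / 2, w⟩, ⟨-t / 2, w⟩} : Set ℂ)
    -- The ray from the apex of the legs through `z` cuts base and top in the same proportion, so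
    -- two points with equal weights, joined at height im, recover `z`.
    have hbase := hc (hsub (Or.inl rfl)) (hsub (Or.inr (Or.inl rfl))) hs1 hs2 (by ring)
    have htop := hc (hsub (Or.inr (Or.inr (Or.inr rfl)))) (hsub (Or.inr (Or.inr (Or.inl rfl))))
      hs1 hs2 (by ring)
    have := hc hbase htop hy hy' (by ring)
    rw [isoTrapezoid]
    convert this using 1
    have hwL : w * L = (w - z.im) * (b / 2) + z.im * (t / 2) := by rw [hL]; field_simp
    apply Complex.ext
    · simp only [Complex.add_re, Complex.real_smul, Complex.re_ofReal_mul]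
      field_simp
      linear_combination 4 * z.re * hwL
    · simp only [Complex.add_im, Complex.real_smul, Complex.im_ofReal_mul]
      field_simp
      ring

section Pinwheel

variable {q : ℕ} (hq : 1 < q) {w : ℝ} (hw : 0 < w) (h : ℂ → ℝ)

include hq in
lemma cos_two_mul_tilt_pos : 0 < Real.cos (2 * tilt q) := Real.cos_pos_of_mem_Ioo
  ⟨by linarith [tilt_pos q, Real.pi_pos], by linarith [tilt_lt hq, tilt_pos q]⟩

include hq in
lemma sin_two_mul_tilt_pos : 0 < Real.sin (2 * tilt q) := by
  rw [Real.sin_two_mul]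
  exact mul_pos (mul_pos two_pos (sin_tilt_pos hq)) (cos_tilt_pos hq)

lemma two_mul_tilt (q : ℕ) : Real.pi / (2 * q + 1) = 2 * tilt q := by
  unfold tilt; field_simp

include hq hw in
-- Multiplication by i stands the strip on its inner border. The two fold conditions together say
-- |im| ≤ (ρ - re sin ε) / cos ε, whose values at re = 0 and re = w are b/2 and t/2.
lemma mem_isoTrapezoid_iff_frame (i : ZMod (2 * q + 1)) (z : ℂ) :
    Complex.I * frame q i z ∈ isoTrapezoid (2 * w / Real.sin (2 * tilt q))
      (2 * w * Real.cot (2 * tilt q)) w ↔ z ∈ (starRibbon q w h).piece i := by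
  have h1 := sin_two_mul_tilt_pos hq
  have h2 := cos_two_mul_tilt_pos hq
  have h3 := sin_tilt_pos hq
  have h4 := cos_tilt_pos hq
  have h5 := circumradius_mul_sin hq w
  rw [mem_isoTrapezoid (by positivity) (by rw [Real.cot_eq_cos_div_sin]; positivity) hw,
    mem_starRibbon_piece hq hw, Complex.I_mul_re, Complex.I_mul_im, abs_neg]
  refine and_congr_right fun _ => ?_
  generalize (frame q i z).re = x, (frame q i z).im = y
  have e1 : (w - x) * (2 * w / Real.sin (2 * tilt q) / 2) +
      x * (2 * w * Real.cot (2 * tilt q) / 2) = w / Real.cos (tilt q) *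
        (circumradius q w - x * Real.sin (tilt q)) := by
    rw [Real.cot_eq_cos_div_sin, Real.sin_two_mul, Real.cos_two_mul, circumradius, Real.cos_sq']
    field_simp
    ring
  rw [e1, div_mul_eq_mul_div, mul_div_assoc, mul_le_mul_iff_right₀ hw, le_div_iff₀ h4]
  rcases abs_cases y with ⟨hy, hy'⟩ | ⟨hy, hy'⟩ <;> rw [hy]
  · constructor
    · intro h6; constructor <;> nlinarith
    · rintro ⟨h6, h7⟩; nlinarith
  · constructor
    · intro h6; constructor <;> nlinarith
    · rintro ⟨h6, h7⟩; nlinarith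

include hq hw in
lemma exists_isometry_piece (i : ZMod (2 * q + 1)) : ∃ e : ℂ ≃ᵢ ℂ, e 0 = 0 ∧
    (starRibbon q w h).piece i = e '' isoTrapezoid (2 * w / Real.sin (2 * tilt q))
      (2 * w * Real.cot (2 * tilt q)) w := by
  let a : Circle := ⟨-Complex.I * edgeDir q i, mem_sphere_zero_iff_norm.2 <| by
    rw [norm_mul, norm_neg, Complex.norm_I, norm_edgeDir, mul_one]⟩
  refine ⟨(rotation a).toIsometryEquiv, map_zero (rotation a), ?_⟩
  ext z
  rw [← mem_isoTrapezoid_iff_frame hq hw h]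
  have e1 : -Complex.I * edgeDir q i * (Complex.I * frame q i z) = z := by
    linear_combination -edgeDir q i * frame q i z * Complex.I_mul_I + frame_mul_edgeDir q i z
  constructor
  · intro hz
    exact ⟨_, hz, e1⟩
  · rintro ⟨y, hy, rfl⟩
    convert hy using 1
    have e2 : (rotation a).toIsometryEquiv y = -Complex.I * y * edgeDir q i := by
      change -Complex.I * edgeDir q i * y = _
      ring
    rw [e2, frame_edgeDir_mul]
    linear_combination -y * Complex.I_mul_I

include hq hw in
lemma piece_add_one (i : ZMod (2 * q + 1)) : (starRibbon q w h).piece (i + 1) =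
    (fun z : ℂ => vertexDir q 1 * z) '' (starRibbon q w h).piece i := by
  have e1 : ∀ z, frame q (i + 1) (vertexDir q 1 * z) = frame q i z := fun z => by
    rw [frame, frame, edgeDir, edgeDir, vertexDir_add, map_mul, map_mul, map_mul]
    linear_combination z * (starRingEnd ℂ) (vertexDir q i) * (starRingEnd ℂ) (halfTurn q) *
      vertexDir_mul_conj q 1
  have e2 : ∀ z, vertexDir q 1 * z ∈ (starRibbon q w h).piece (i + 1) ↔
      z ∈ (starRibbon q w h).piece i := fun z => by
    rw [mem_starRibbon_piece hq hw, mem_starRibbon_piece hq hw, e1]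
  ext z
  constructor
  · intro hz
    have e3 : vertexDir q 1 * ((starRingEnd ℂ) (vertexDir q 1) * z) = z := by
      linear_combination z * vertexDir_mul_conj q 1
    exact ⟨_, (e2 _).1 (by rwa [e3]), e3⟩
  · rintro ⟨y, hy, rfl⟩
    exact (e2 y).2 hy

include hq in
-- Modulo 4n, a residue 3 mod 4 with nonnegative sine lies in [3, 2n - 3], so the sine is at least
-- sin 3ε. This exceeds 2 sin ε because sin ε < 1/2, with equality for q = 1.
lemma not_sin_le_two_mul_sin_tilt {o : ℤ} (ho : o % 4 = 3) (h0 : 0 ≤ Real.sin (o * tilt q)) :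
    2 * Real.sin (tilt q) < Real.sin (o * tilt q) := by
  have hε := tilt_pos q
  have hε' := tilt_lt hq
  have hn := two_mul_add_one_mul_tilt q
  have h3 : 2 * Real.sin (tilt q) < Real.sin (3 * tilt q) := by
    have h1 : Real.sin (tilt q) < 1 / 2 := by
      rw [← Real.sin_pi_div_six]
      exact Real.sin_lt_sin_of_lt_of_le_pi_div_two (by linarith) (by linarith) (by linarith)
    rw [Real.sin_three_mul]
    have h2 := sin_tilt_pos hq
    have : Real.sin (tilt q) ^ 2 < 1 / 4 := by nlinarith
    nlinarith
  refine h3.trans_le ?_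
  have key : ∀ p : ℤ, 3 ≤ p → p ≤ 2 * q + 1 → Real.sin (3 * tilt q) ≤ Real.sin (p * tilt q) := by
    intro p hp1 hp2
    have hp1 : (3 : ℝ) ≤ p := by exact_mod_cast hp1
    have hp2 : (p : ℝ) ≤ 2 * q + 1 := by exact_mod_cast hp2
    refine Real.sin_le_sin_of_le_of_le_pi_div_two (by linarith) ?_ ?_
    · rw [← hn]; gcongr
    · gcongr
  set p := o % (4 * (2 * q + 1)) with hp
  have hpo : p + 4 * (2 * q + 1) * (o / (4 * (2 * q + 1))) = o := Int.emod_add_mul_ediv _ _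
  have hp0 : 0 ≤ p := Int.emod_nonneg _ (by positivity)
  have hp1 : p < 4 * (2 * q + 1) := Int.emod_lt_of_pos _ (by positivity)
  have hp4 : p % 4 = 3 := by rw [hp, Int.emod_emod_of_dvd _ (Dvd.intro _ rfl), ho]
  have hsin : Real.sin (o * tilt q) = Real.sin (p * tilt q) := by
    rw [← hpo, ← Real.sin_add_int_mul_two_pi (p * tilt q) (o / (4 * (2 * q + 1)))]
    congr 1
    push_cast
    linear_combination 4 * ((o / (4 * (2 * q + 1)) : ℤ) : ℝ) * hn
  rw [hsin] at h0 ⊢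
  rcases le_or_gt p (2 * q + 1) with h5 | h5
  · exact key p (by omega) h5
  rcases le_or_gt p (4 * q - 1) with h6 | h6
  · have := key (2 * (2 * q + 1) - p) (by omega) (by omega)
    rw [← Real.sin_pi_sub (p * tilt q)]
    refine this.trans_eq (congrArg Real.sin ?_)
    push_cast
    linear_combination 2 * hn
  · have h7 : (2 * (2 * q + 1) : ℝ) + 1 ≤ p := by
      have : 2 * (2 * q + 1) + 1 ≤ p := by omega
      exact_mod_cast this
    have h8 : (p : ℝ) < 4 * (2 * q + 1) := by exact_mod_cast hp1
    have := Real.sin_neg_of_neg_of_neg_pi_lt (x := p * tilt q - 2 * Real.pi) (by nlinarith)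
      (by nlinarith)
    rw [Real.sin_sub_two_pi] at this
    linarith

include hq hw in
-- Two corners at distance ρ / cos ε from the centre, an angle 2ε apart, have a midpoint at distance
-- ρ. In the frame of piece k its real part is ρ sin((4qk - 1)ε), never in [0, w] = [0, 2ρ sin ε].
lemma not_convex_iUnion_piece : ¬ Convex ℝ (⋃ i, (starRibbon q w h).piece i) := by
  intro hc
  have hs := sin_tilt_pos hq
  have hcos := cos_tilt_pos hq
  have hρ := circumradius_mul_sin hq w
  have hρ0 := circumradius_pos hq hw
  have hn := two_mul_add_one_mul_tilt q
  set B := circumradius q w / Real.cos (tilt q) with hB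
  have hB0 : 0 < B := div_pos hρ0 hcos
  have hBc : B * Real.cos (tilt q) = circumradius q w := div_mul_cancel₀ _ hcos.ne'
  -- A base corner of piece 0.
  have h1 : Complex.I * B * edgeDir q 0 ∈ ⋃ i, (starRibbon q w h).piece i := by
    refine Set.mem_iUnion.2 ⟨0, (mem_starRibbon_piece hq hw _ _ _).2 ?_⟩
    rw [frame_edgeDir_mul, Complex.I_mul_re, Complex.I_mul_im, Complex.ofReal_re,
      Complex.ofReal_im]
    refine ⟨⟨by simp, by simpa using hw.le⟩, ?_, ?_⟩ <;> linarith
  -- A top corner of piece -2. Two steps back turn by -4β, which is 4ε modulo 2π, so this corner is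
  -- at angle π/2 + 2ε in the frame of piece 0.
  have h2 : (B * Complex.exp ((Real.pi / 2 - 2 * tilt q : ℝ) * Complex.I)) * edgeDir q (-2) ∈
      ⋃ i, (starRibbon q w h).piece i := by
    refine Set.mem_iUnion.2 ⟨-2, (mem_starRibbon_piece hq hw _ _ _).2 ?_⟩
    rw [frame_edgeDir_mul, Complex.re_ofReal_mul, Complex.im_ofReal_mul,
      Complex.exp_ofReal_mul_I_re, Complex.exp_ofReal_mul_I_im, Real.cos_pi_div_two_sub,
      Real.sin_pi_div_two_sub, Real.sin_two_mul, Real.cos_two_mul]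
    have h5 : B * (2 * Real.sin (tilt q) * Real.cos (tilt q)) = w := by
      linear_combination 2 * Real.sin (tilt q) * hBc + 2 * hρ
    rw [h5]
    have h6 := Real.sin_sq_add_cos_sq (tilt q)
    have h7 : w * Real.sin (tilt q) + B * (2 * Real.cos (tilt q) ^ 2 - 1) * Real.cos (tilt q) =
        circumradius q w := by
      linear_combination -2 * Real.sin (tilt q) * hρ +
        (2 * Real.cos (tilt q) ^ 2 - 1) * hBc + 2 * circumradius q w * h6
    have h8 : 0 < B * (2 * Real.cos (tilt q) ^ 2 - 1) * Real.cos (tilt q) := by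
      rw [← Real.cos_two_mul]
      exact mul_pos (mul_pos hB0 (cos_two_mul_tilt_pos hq)) hcos
    exact ⟨⟨hw.le, le_rfl⟩, by linarith, h7.le⟩
  have h3 := hc h1 h2 (a := 1 / 2) (b := 1 / 2) (by norm_num) (by norm_num) (by norm_num)
  have e1 : edgeDir q (-2) = Complex.exp ((4 * tilt q : ℝ) * Complex.I) * edgeDir q 0 := by
    have e2 : vertexDir q (-2) = Complex.exp ((4 * tilt q : ℝ) * Complex.I) := by
      have e3 := vertexDir_intCast q (-2)
      rw [Int.cast_neg, Int.cast_ofNat] at e3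
      rw [e3]
      refine Complex.exp_eq_exp_iff_exists_int.2 ⟨-1, ?_⟩
      have e4 : (2 * halfAngle q * ((-2 : ℤ) : ℝ) : ℝ) = 4 * tilt q - 2 * Real.pi := by
        unfold halfAngle; push_cast; linarith
      rw [e4]
      push_cast
      ring
    rw [edgeDir, edgeDir, e2, show vertexDir q 0 = 1 by simp [vertexDir], one_mul]
  have e5 : (1 / 2 : ℝ) • (Complex.I * B * edgeDir q 0) + (1 / 2 : ℝ) •
      ((B * Complex.exp ((Real.pi / 2 - 2 * tilt q : ℝ) * Complex.I)) * edgeDir q (-2)) =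
      circumradius q w * Complex.exp ((Real.pi / 2 + tilt q : ℝ) * Complex.I) * edgeDir q 0 := by
    have e6 : Complex.I = Complex.exp ((Real.pi / 2 + tilt q : ℝ) * Complex.I) *
        Complex.exp ((-tilt q : ℝ) * Complex.I) := by
      rw [← Complex.exp_add, ← add_mul, ← Complex.ofReal_add, add_neg_cancel_right]
      push_cast
      rw [Complex.exp_pi_div_two_mul_I]
    have e7 : Complex.exp ((Real.pi / 2 - 2 * tilt q : ℝ) * Complex.I) *
        Complex.exp ((4 * tilt q : ℝ) * Complex.I) =
        Complex.exp ((Real.pi / 2 + tilt q : ℝ) * Complex.I) *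
          Complex.exp ((tilt q : ℝ) * Complex.I) := by
      rw [← Complex.exp_add, ← Complex.exp_add]
      congr 1
      push_cast
      ring
    have e8 : (circumradius q w : ℂ) = B * Complex.cos (tilt q) := by
      rw [← hBc]; push_cast; rfl
    have e9 := Complex.two_cos (tilt q)
    rw [e1, Complex.real_smul, Complex.real_smul, e8]
    push_cast at e6 e7 e9 ⊢
    linear_combination 1 / 2 * B * edgeDir q 0 * e6 + 1 / 2 * B * edgeDir q 0 * e7 -
      1 / 2 * B * edgeDir q 0 * Complex.exp ((Real.pi / 2 + tilt q) * Complex.I) * e9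
  rw [e5] at h3
  obtain ⟨j, hj⟩ := Set.mem_iUnion.1 h3
  obtain ⟨k, rfl⟩ := ZMod.intCast_surjective j
  have e10 : (frame q k (circumradius q w * Complex.exp ((Real.pi / 2 + tilt q : ℝ) * Complex.I) *
      edgeDir q 0)).re = circumradius q w * Real.sin ((4 * q * k - 1 : ℤ) * tilt q) := by
    have e11 : edgeDir q 0 = Complex.exp ((-(2 * halfAngle q * k) : ℝ) * Complex.I) *
        edgeDir q k := by
      rw [edgeDir, edgeDir, vertexDir_intCast, ← mul_assoc, ← Complex.exp_add, ← add_mul,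
        ← Complex.ofReal_add, neg_add_cancel]
      simp [vertexDir]
    rw [e11, ← mul_assoc, frame_edgeDir_mul, mul_assoc, ← Complex.exp_add, ← add_mul,
      ← Complex.ofReal_add, Complex.re_ofReal_mul, Complex.exp_ofReal_mul_I_re,
      ← Real.cos_pi_div_two_sub]
    congr 2
    unfold halfAngle
    push_cast
    ring
  rw [mem_starRibbon_piece hq hw, e10] at hj
  have h4 := not_sin_le_two_mul_sin_tilt hq (o := 4 * q * k - 1) (by rw [mul_assoc]; omega)
    (nonneg_of_mul_nonneg_right hj.1.1 hρ0)
  nlinarith [hj.1.2]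

include hq hw in
theorem starRibbon_isPinwheel : (starRibbon q w h).IsPinwheel
    (2 * w / Real.sin (Real.pi / (2 * q + 1))) (2 * w * Real.cot (Real.pi / (2 * q + 1))) := by
  have h1 := sin_two_mul_tilt_pos hq
  have h2 := cos_two_mul_tilt_pos hq
  rw [two_mul_tilt]
  refine ⟨?_, ?_, 0, fun i => exists_isometry_piece hq hw h i,
    ⟨q, natCoprime_two_mul_add_one q, fun i => ?_⟩, not_convex_iUnion_piece hq hw h⟩
  · rw [Real.cot_eq_cos_div_sin]; positivity
  · rw [Real.cot_eq_cos_div_sin, ← mul_div_assoc]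
    have h3 := Real.sin_sq_add_cos_sq (2 * tilt q)
    have : Real.cos (2 * tilt q) < 1 := by nlinarith
    exact div_lt_div_of_pos_right (by nlinarith) h1
  · rw [piece_add_one hq hw]
    have e1 : Complex.exp (2 * Real.pi * q / (2 * q + 1 : ℕ) * Complex.I) = vertexDir q 1 := by
      have := vertexDir_intCast q 1
      rw [Int.cast_one] at this
      rw [this]
      have : (2 * (q : ℂ) + 1) ≠ 0 := by exact_mod_cast (Nat.succ_ne_zero (2 * q))
      unfold halfAngle tilt
      push_cast
      congr 1
      field_simp
    rw [e1]
    simp only [sub_zero, zero_add]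

end Pinwheel

/-! ### Ambient isotopies by radial maps -/

lemma AmbientIsotopic.symm {K K' : Set (ℂ × ℝ)} (h : AmbientIsotopic K K') :
    AmbientIsotopic K' K := by
  obtain ⟨H, hc, h0, h1⟩ := h
  -- Undo the final homeomorphism, then run the isotopy backwards.
  refine ⟨fun t => (H 1).symm.trans (H (unitInterval.symm t)), ?_, fun x => ?_, ?_⟩
  · have : Continuous fun p : unitInterval × (ℂ × ℝ) =>
        ((unitInterval.symm p.1, (H 1).symm p.2) : unitInterval × (ℂ × ℝ)) := by fun_prop
    exact hc.comp this
  · change H (unitInterval.symm 0) ((H 1).symm x) = x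
    rw [unitInterval.symm_zero, Homeomorph.apply_symm_apply]
  · rw [← h1]
    ext x
    constructor
    · rintro ⟨_, ⟨y, hy, rfl⟩, rfl⟩
      change H (unitInterval.symm 1) ((H 1).symm (H 1 y)) ∈ K
      rwa [unitInterval.symm_one, Homeomorph.symm_apply_apply, h0]
    · intro hx
      refine ⟨H 1 x, ⟨x, hx, rfl⟩, ?_⟩
      change H (unitInterval.symm 1) ((H 1).symm (H 1 x)) = x
      rw [unitInterval.symm_one, Homeomorph.symm_apply_apply, h0]

/-- A radial map of the plane is a homeomorphism if it is strictly increasing and proper on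
rays. -/
lemma isHomeomorph_radial {μ : ℝ → ℝ} (hc : Continuous μ) (hpos : ∀ r, 0 < μ r)
    (hmono : StrictMonoOn (fun r => r * μ r) (Set.Ici 0)) {C : ℝ}
    (hC : ∀ r, 0 ≤ r → r - C ≤ r * μ r) :
    IsHomeomorph fun u : ℂ => (μ ‖u‖ : ℂ) * u := by
  have hcont : Continuous fun u : ℂ => (μ ‖u‖ : ℂ) * u := by fun_prop
  have hnorm : ∀ u : ℂ, ‖(μ ‖u‖ : ℂ) * u‖ = ‖u‖ * μ ‖u‖ := fun u => by
    rw [norm_mul, Complex.norm_real, Real.norm_of_nonneg (hpos _).le, mul_comm]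
  refine isHomeomorph_iff_continuous_isClosedMap_bijective.2 ⟨hcont, ?_, ?_, ?_⟩
  -- The lower bound r - C sends norms to infinity, so the map is proper and hence closed.
  · refine IsProperMap.isClosedMap (isProperMap_iff_tendsto_cocompact.2 ⟨hcont, ?_⟩)
    refine tendsto_cocompact_of_tendsto_dist_comp_atTop 0 ?_
    refine Filter.tendsto_atTop_mono (fun u => ?_)
      (Filter.tendsto_atTop_add_const_right _ (-C) (tendsto_norm_cocompact_atTop (E := ℂ)))
    rw [dist_zero_right, hnorm]
    exact hC _ (norm_nonneg u)
  · intro u v huv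
    have h1 : ‖u‖ = ‖v‖ := by
      refine hmono.injOn (norm_nonneg u) (norm_nonneg v) ?_
      change ‖u‖ * μ ‖u‖ = ‖v‖ * μ ‖v‖
      rw [← hnorm, ← hnorm]
      exact congrArg norm huv
    simp only [h1] at huv
    exact mul_left_cancel₀ (Complex.ofReal_ne_zero.2 (hpos _).ne') huv
  · intro v
    have h1 : ContinuousOn (fun r => r * μ r) (Set.Icc 0 (max 0 (‖v‖ + C))) := by fun_prop
    obtain ⟨r, hr, hrv⟩ := intermediate_value_Icc (le_max_left _ _) h1
      (show ‖v‖ ∈ _ from ⟨by simp, by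
        linarith [hC _ (le_max_left 0 (‖v‖ + C)), le_max_right 0 (‖v‖ + C)]⟩)
    simp only at hrv
    have h2 : ‖v / (μ r : ℂ)‖ = r := by
      rw [norm_div, Complex.norm_real, Real.norm_of_nonneg (hpos _).le, ← hrv,
        mul_div_cancel_right₀ _ (hpos r).ne']
    refine ⟨v / μ r, ?_⟩
    simp only [h2]
    exact mul_div_cancel₀ v (Complex.ofReal_ne_zero.2 (hpos _).ne')

/-- Interpolating the scale factor linearly with 1 preserves positivity, strict growth along rays
and, as C ≥ 0, the lower bound. Every stage is therefore a homeomorphism. -/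
lemma ambientIsotopic_radial {μ : ℝ → ℝ} (hc : Continuous μ) (hpos : ∀ r, 0 < μ r)
    (hmono : StrictMonoOn (fun r => r * μ r) (Set.Ici 0)) {C : ℝ} (hC0 : 0 ≤ C)
    (hC : ∀ r, 0 ≤ r → r - C ≤ r * μ r) (K : Set (ℂ × ℝ)) :
    AmbientIsotopic K ((fun p : ℂ × ℝ => ((μ ‖p.1‖ : ℂ) * p.1, p.2)) '' K) := by
  have hH : ∀ t : unitInterval, IsHomeomorph fun u : ℂ =>
      (((1 - t) + t * μ ‖u‖ : ℝ) : ℂ) * u := by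
    intro t
    have ht0 := t.2.1
    have ht1 := t.2.2
    refine isHomeomorph_radial (μ := fun r => (1 - t) + t * μ r) (C := C) (by fun_prop)
      (fun r => ?_) (fun r hr s hs hrs => ?_) (fun r hr => ?_)
    · rcases ht1.eq_or_lt with h | h
      · rw [h]; simpa using hpos r
      · exact add_pos_of_pos_of_nonneg (sub_pos.2 h) (mul_nonneg ht0 (hpos r).le)
    · have h1 := hmono hr hs hrs
      simp only at h1 ⊢
      rcases ht1.eq_or_lt with h | h
      · rw [h]; linarith
      · nlinarith
    · have h1 := hC r hr
      nlinarith
  refine ⟨fun t => (hH t).homeomorph.prodCongr (Homeomorph.refl ℝ), ?_, fun x => ?_, ?_⟩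
  · change Continuous fun p : unitInterval × (ℂ × ℝ) =>
      (((((1 - p.1) + p.1 * μ ‖p.2.1‖ : ℝ) : ℂ) * p.2.1, p.2.2) : ℂ × ℝ)
    fun_prop
  · change (((((1 - (0 : unitInterval)) + (0 : unitInterval) * μ ‖x.1‖ : ℝ) : ℂ) * x.1, x.2)) = x
    simp
  · refine Set.image_congr fun x _ => ?_
    change (((((1 - (1 : unitInterval)) + (1 : unitInterval) * μ ‖x.1‖ : ℝ) : ℂ) * x.1, x.2)) = _
    simp

/-! ### The change of radius from the torus knot to the star polygon -/

/-- The radius on the star polygon that corresponds to radius `r` on the torus. -/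
def starRadius (q : ℕ) (w r : ℝ) : ℝ :=
  w / 2 / Real.cos (halfAngle q / Real.pi * Real.arccos (2 - r)) + max 0 (r - 3)

/-- The factor by which radii change from the torus to the star polygon. -/
def starScale (q : ℕ) (w r : ℝ) : ℝ := starRadius q w (max r 1) / max r 1

section Scale

variable {q : ℕ} (hq : 1 < q) {w : ℝ} (hw : 0 < w)

include hq in
lemma starAngle_mem (r : ℝ) : halfAngle q / Real.pi * Real.arccos (2 - r) ∈
    Set.Ico 0 (Real.pi / 2) := by
  have h1 := halfAngle_pos hq
  have h2 := Real.pi_pos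
  refine ⟨mul_nonneg (by positivity) (Real.arccos_nonneg _), ?_⟩
  calc halfAngle q / Real.pi * Real.arccos (2 - r) ≤ halfAngle q / Real.pi * Real.pi := by
        gcongr; exact Real.arccos_le_pi _
    _ = halfAngle q := div_mul_cancel₀ _ h2.ne'
    _ < Real.pi / 2 := halfAngle_lt q

include hq in
lemma cos_starAngle_pos (r : ℝ) :
    0 < Real.cos (halfAngle q / Real.pi * Real.arccos (2 - r)) :=
  Real.cos_pos_of_mem_Ioo
    ⟨by linarith [(starAngle_mem hq r).1, Real.pi_pos], (starAngle_mem hq r).2⟩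

include hq hw in
lemma starRadius_pos (r : ℝ) : 0 < starRadius q w r :=
  add_pos_of_pos_of_nonneg (div_pos (half_pos hw) (cos_starAngle_pos hq r)) (le_max_left _ _)

include hq hw in
-- Up to radius 3 the arccosine grows strictly. Beyond 3 it is constantly π, and the added r - 3
-- takes over.
lemma strictMonoOn_starRadius : StrictMonoOn (starRadius q w) (Set.Ici 1) := by
  intro r hr s hs hrs
  have h1 := halfAngle_pos hq
  have h2 := Real.pi_pos
  have hr : 1 ≤ r := hr
  have hpr := cos_starAngle_pos hq r
  have hps := cos_starAngle_pos hq s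
  have ha := div_pos h1 h2
  unfold starRadius
  rcases le_or_gt s 3 with h3 | h3
  · refine add_lt_add_of_lt_of_le (div_lt_div_of_pos_left (half_pos hw) hps ?_)
      (max_le_max le_rfl (by linarith))
    refine Real.cos_lt_cos_of_nonneg_of_le_pi (starAngle_mem hq r).1
      (by linarith [(starAngle_mem hq s).2]) (mul_lt_mul_of_pos_left ?_ ha)
    exact Real.arccos_lt_arccos (by linarith) (by linarith) (by linarith)
  · refine add_lt_add_of_le_of_lt (div_le_div_of_nonneg_left (half_pos hw).le hps ?_) ?_
    · refine Real.cos_le_cos_of_nonneg_of_le_pi (starAngle_mem hq r).1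
        (by linarith [(starAngle_mem hq s).2]) (mul_le_mul_of_nonneg_left ?_ ha.le)
      exact Real.antitone_arccos (by linarith)
    · rw [max_eq_right (by linarith : 0 ≤ s - 3)]
      exact max_lt (by linarith) (by linarith)

include hq in
lemma continuous_starRadius : Continuous (starRadius q w) := by
  unfold starRadius
  refine Continuous.add (continuous_const.div ?_ fun r => (cos_starAngle_pos hq r).ne') ?_
  · exact Real.continuous_cos.comp (continuous_const.mul
      (Real.continuous_arccos.comp (continuous_const.sub continuous_id)))
  · fun_prop

/-- Below radius 1 the radial map is linear, which makes it regular at the centre; the torus knot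
has radii in [1, 3]. -/
lemma mul_starScale (q : ℕ) (w r : ℝ) :
    r * starScale q w r = min r 1 * starRadius q w (max r 1) := by
  have h1 : 0 < max r 1 := lt_max_of_lt_right one_pos
  rw [starScale]
  field_simp
  linear_combination -starRadius q w (max r 1) * min_mul_max r 1

include hq hw in
lemma starScale_pos (r : ℝ) : 0 < starScale q w r :=
  div_pos (starRadius_pos hq hw _) (lt_max_of_lt_right one_pos)

include hq in
lemma continuous_starScale : Continuous (starScale q w) :=
  ((continuous_starRadius hq).comp (continuous_id.max continuous_const)).div
    (continuous_id.max continuous_const) fun _ => (lt_max_of_lt_right one_pos).ne'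

include hq hw in
lemma strictMonoOn_mul_starScale : StrictMonoOn (fun r => r * starScale q w r) (Set.Ici 0) := by
  intro r hr s hs hrs
  have hr : 0 ≤ r := hr
  simp only [mul_starScale]
  rcases lt_or_ge r 1 with h | h
  · have h1 : min r 1 < min s 1 := by
      rw [min_eq_left h.le]; exact lt_min hrs h
    refine mul_lt_mul h1 ?_ (starRadius_pos hq hw _) (le_min (by linarith) one_pos.le)
    exact (strictMonoOn_starRadius hq hw).monotoneOn
      (Set.mem_Ici.2 (le_max_right _ _)) (Set.mem_Ici.2 (le_max_right _ _)) (max_le_max hrs.le le_rfl)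
  · rw [min_eq_right h, min_eq_right (by linarith), max_eq_left h, max_eq_left (by linarith),
      one_mul, one_mul]
    exact strictMonoOn_starRadius hq hw h (h.trans hrs.le) hrs

include hq hw in
lemma sub_three_le_mul_starScale (r : ℝ) (hr : 0 ≤ r) : r - 3 ≤ r * starScale q w r := by
  rcases le_or_gt r 3 with h | h
  · exact (sub_nonpos.2 h).trans (mul_nonneg hr (starScale_pos hq hw r).le)
  · rw [mul_starScale, min_eq_right (by linarith), max_eq_left (by linarith), one_mul, starRadius,
      max_eq_right (by linarith)]
    have := div_pos (half_pos hw) (cos_starAngle_pos hq r)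
    linarith

end Scale

/-! ### The centre line as the image of the torus knot -/

section Knot

variable {q : ℕ} (hq : 1 < q) {w : ℝ} (hw : 0 < w)

/-- The point of the centre line of a piece, in its frame, at the fraction `x` of the angle from
the midpoint. -/
def chordPoint (q : ℕ) (w x : ℝ) : ℂ :=
  (w / 2 / Real.cos (halfAngle q * x) : ℝ) * Complex.exp ((halfAngle q * x : ℝ) * Complex.I)

include hq in
lemma abs_halfAngle_mul_le {x : ℝ} (hx : |x| ≤ 1) : |halfAngle q * x| ≤ halfAngle q := by
  rw [abs_mul, abs_of_pos (halfAngle_pos hq)]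
  exact mul_le_of_le_one_right (halfAngle_pos hq).le hx

include hq in
lemma sin_tilt_le_cos {x : ℝ} (hx : |x| ≤ 1) :
    Real.sin (tilt q) ≤ Real.cos (halfAngle q * x) := by
  rw [← cos_halfAngle, ← Real.cos_abs (halfAngle q * x)]
  exact Real.cos_le_cos_of_nonneg_of_le_pi (abs_nonneg _)
    (by linarith [halfAngle_lt q, Real.pi_pos]) (abs_halfAngle_mul_le hq hx)

include hq in
lemma cos_halfAngle_mul_pos {x : ℝ} (hx : |x| ≤ 1) : 0 < Real.cos (halfAngle q * x) :=
  (sin_tilt_pos hq).trans_le (sin_tilt_le_cos hq hx)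

include hq in
lemma chordPoint_eq {x : ℝ} (hx : |x| ≤ 1) :
    chordPoint q w x = ⟨w / 2, w / 2 * Real.tan (halfAngle q * x)⟩ := by
  have h1 := cos_halfAngle_mul_pos hq hx
  apply Complex.ext
  · rw [chordPoint, Complex.re_ofReal_mul, Complex.exp_ofReal_mul_I_re]
    exact div_mul_cancel₀ _ h1.ne'
  · rw [chordPoint, Complex.im_ofReal_mul, Complex.exp_ofReal_mul_I_im, Real.tan_eq_sin_div_cos]
    simp only
    ring

include hq hw in
-- On the centre line the gap is 0 and the chord angle is β|x|, so the height is 2 sin(πx/2)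
-- cos(πx/2).
lemma sheetHeight_chordPoint {x : ℝ} (hx : |x| ≤ 1) :
    sheetHeight q w (chordPoint q w x) = Real.sin (Real.pi * x) := by
  have hβ := halfAngle_pos hq
  have h1 := cos_halfAngle_mul_pos hq hx
  have h2 := abs_le.1 (abs_halfAngle_mul_le hq hx)
  have h3 : 0 < w / 2 / Real.cos (halfAngle q * x) := div_pos (half_pos hw) h1
  have hπ := Real.pi_pos
  have hlt := halfAngle_lt q
  have harg : (chordPoint q w x).arg = halfAngle q * x := by
    rw [chordPoint, Complex.exp_mul_I]
    exact Complex.arg_mul_cos_add_sin_mul_I h3 ⟨by linarith, by linarith⟩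
  have hnorm : ‖chordPoint q w x‖ = w / 2 / Real.cos (halfAngle q * x) := by
    rw [chordPoint, norm_mul, Complex.norm_exp_ofReal_mul_I, mul_one, Complex.norm_real,
      Real.norm_of_nonneg h3.le]
  have hle : ‖chordPoint q w x‖ ≤ circumradius q w := by
    rw [hnorm, circumradius]
    exact div_le_div_of_nonneg_left (half_pos hw).le (sin_tilt_pos hq) (sin_tilt_le_cos hq hx)
  have hgap : creaseGap q w (chordPoint q w x) = 0 := by
    -- Pythagoras with re = w/2; the cap at ρ is inactive on the edge.
    have e1 : ‖chordPoint q w x‖ ^ 2 - (w / 2) ^ 2 = (chordPoint q w x).im ^ 2 := by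
      rw [← Complex.normSq_eq_norm_sq, Complex.normSq_apply, chordPoint_eq hq hx]
      simp only
      ring
    rw [creaseGap, min_eq_left hle, e1, Real.sqrt_sq_eq_abs, chordPoint_eq hq hx]
    simp only
    ring
  have hchord : chordAngle q w ‖chordPoint q w x‖ = |halfAngle q * x| := by
    rw [chordAngle, hnorm, div_div_cancel₀ (half_pos hw).ne', max_eq_left (sin_tilt_le_cos hq hx),
      ← Real.cos_abs, Real.arccos_cos (abs_nonneg _)
        (by linarith [abs_halfAngle_mul_le hq hx])]
  rw [sheetHeight, creaseFactor, hgap, abs_zero, mul_zero, add_zero, harg, radialFactor, hchord,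
    abs_mul, abs_of_pos hβ, show Real.pi * (halfAngle q * |x|) / (2 * halfAngle q) =
      |Real.pi * x / 2| by rw [abs_div, abs_mul, abs_of_pos hπ, abs_two]; field_simp,
    Real.cos_abs, show Real.pi * (halfAngle q * x) / (2 * halfAngle q) = Real.pi * x / 2 by
      field_simp, show Real.pi * x = 2 * (Real.pi * x / 2) by ring, Real.sin_two_mul,
    show 2 * (Real.pi * x / 2) / 2 = Real.pi * x / 2 by ring]
  ring

include hq hw in
-- The edge is traversed by polar angle: its coordinate is (w/2) tan(βx), with half-length (w/2) tan
-- β = ρ cos ε.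
lemma mem_segment_iff (h : ℂ → ℝ) (i : ZMod (2 * q + 1)) (z : ℂ) :
    z ∈ segment ℝ ((starRibbon q w h).vertex i) ((starRibbon q w h).vertex (i + 1)) ↔
      ∃ x : ℝ, |x| ≤ 1 ∧ z = chordPoint q w x * edgeDir q i := by
  have hβ := halfAngle_pos hq
  have hρ := circumradius_mul_sin hq w
  have hc := cos_tilt_pos hq
  have hs := sin_tilt_pos hq
  have hρ0 := circumradius_pos hq hw
  have htan : w / 2 * Real.tan (halfAngle q) = circumradius q w * Real.cos (tilt q) := by
    rw [Real.tan_eq_sin_div_cos, sin_halfAngle, cos_halfAngle, circumradius]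
    ring
  have e1 : ∀ t : ℝ, (starRibbon q w h).vertex i +
      t • ((starRibbon q w h).vertex (i + 1) - (starRibbon q w h).vertex i) =
      (⟨w / 2, circumradius q w * Real.cos (tilt q) * (2 * t - 1)⟩ : ℂ) * edgeDir q i := by
    intro t
    have e2 : (⟨w / 2, circumradius q w * Real.cos (tilt q) * (2 * t - 1)⟩ : ℂ) =
        circumradius q w * (starRingEnd ℂ) (halfTurn q) +
          t * ((2 * circumradius q w * Real.cos (tilt q) : ℝ) * Complex.I) := by
      apply Complex.ext
      · simp [halfTurn_re, ← hρ]
      · rw [Complex.add_im, Complex.im_ofReal_mul, Complex.im_ofReal_mul, Complex.im_ofReal_mul,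
          Complex.conj_im, halfTurn_im, Complex.I_im]
        ring
    rw [starRibbon_edge, starRibbon_vertex_eq, e2, Complex.real_smul]
    ring
  rw [segment_eq_image']
  constructor
  · rintro ⟨t, ⟨ht0, ht1⟩, rfl⟩
    simp only [e1]
    set y := circumradius q w * Real.cos (tilt q) * (2 * t - 1) with hy
    have h1 : y / (w / 2) ≤ Real.tan (halfAngle q) := by
      rw [div_le_iff₀ (half_pos hw), mul_comm, htan, hy]
      nlinarith [mul_pos hρ0 hc]
    have h2 : -Real.tan (halfAngle q) ≤ y / (w / 2) := by
      rw [le_div_iff₀ (half_pos hw), neg_mul, mul_comm, htan, hy]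
      nlinarith [mul_pos hρ0 hc]
    have harctan : Real.arctan (Real.tan (halfAngle q)) = halfAngle q :=
      Real.arctan_tan (by linarith [Real.pi_pos]) (halfAngle_lt q)
    have h3 := Real.arctan_strictMono.monotone h1
    have h4 := Real.arctan_strictMono.monotone h2
    rw [Real.arctan_neg] at h4
    rw [harctan] at h3 h4
    have hx : |Real.arctan (y / (w / 2)) / halfAngle q| ≤ 1 := by
      rw [abs_div, abs_of_pos hβ, div_le_one hβ, abs_le]
      exact ⟨h4, h3⟩
    refine ⟨_, hx, ?_⟩
    rw [chordPoint_eq hq hx, mul_div_cancel₀ _ hβ.ne', Real.tan_arctan,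
      mul_div_cancel₀ _ (half_pos hw).ne']
  · rintro ⟨x, hx, rfl⟩
    have h1 := abs_le.1 (abs_halfAngle_mul_le hq hx)
    have hmono := Real.strictMonoOn_tan.monotoneOn
    have hβ2 := halfAngle_lt q
    have h2 := hmono ⟨by linarith, by linarith⟩ ⟨by linarith, hβ2⟩ h1.2
    have h3 := hmono ⟨by linarith, by linarith⟩ ⟨by linarith, by linarith⟩ h1.1
    rw [Real.tan_neg] at h3
    have h4 : 0 < Real.tan (halfAngle q) := Real.tan_pos_of_pos_of_lt_pi_div_two hβ hβ2
    have h5 : |Real.tan (halfAngle q * x) / Real.tan (halfAngle q)| ≤ 1 := by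
      rw [abs_div, abs_of_pos h4, div_le_one h4, abs_le]
      exact ⟨h3, h2⟩
    have h6 := abs_le.1 h5
    refine ⟨(1 + Real.tan (halfAngle q * x) / Real.tan (halfAngle q)) / 2,
      ⟨by linarith, by linarith⟩, ?_⟩
    simp only [e1]
    rw [chordPoint_eq hq hx, ← htan]
    congr 2
    field_simp
    ring

include hq in
/-- The radial map carries the torus knot to the centre line of the pinwheel. -/
lemma radial_torusKnot_point {x : ℝ} (hx : |x| ≤ 1) (k : ℤ) {s : ℝ}
    (hs : (2 * q + 1) * s = 2 * Real.pi * k + Real.pi + Real.pi * x) {P : ℂ × ℝ}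
    (hP : P = (((2 + Real.cos ((2 * q + 1 : ℕ) * s) : ℝ) : ℂ) *
      Complex.exp (((q * s : ℝ) : ℂ) * Complex.I), -Real.sin ((2 * q + 1 : ℕ) * s))) :
    ((starScale q w ‖P.1‖ : ℂ) * P.1, P.2) =
      (chordPoint q w x * edgeDir q k, Real.sin (Real.pi * x)) := by
  have hn : (2 * q + 1 : ℝ) ≠ 0 := by positivity
  have hπ := Real.pi_pos
  have hβ := halfAngle_pos hq
  have e1 : ((2 * q + 1 : ℕ) : ℝ) * s = Real.pi * x + Real.pi + k * (2 * Real.pi) := by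
    push_cast; linarith
  have e2 : Real.cos ((2 * q + 1 : ℕ) * s) = -Real.cos (Real.pi * x) := by
    rw [e1, Real.cos_add_int_mul_two_pi, Real.cos_add_pi]
  have e3 : Real.sin ((2 * q + 1 : ℕ) * s) = -Real.sin (Real.pi * x) := by
    rw [e1, Real.sin_add_int_mul_two_pi, Real.sin_add_pi]
  have e4 : (q * s : ℝ) = 2 * halfAngle q * k + halfAngle q + halfAngle q * x := by
    have h1 := two_mul_add_one_mul_tilt q
    refine mul_left_cancel₀ hn ?_
    unfold halfAngle
    linear_combination q * hs - (4 * q * k + 2 * q + 2 * q * x) * h1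
  have e5 : Complex.exp (((q * s : ℝ) : ℂ) * Complex.I) =
      Complex.exp ((halfAngle q * x : ℝ) * Complex.I) * edgeDir q k := by
    rw [edgeDir, vertexDir_intCast, halfTurn, ← Complex.exp_add, ← Complex.exp_add, e4]
    congr 1
    push_cast
    ring
  have hR : 1 ≤ 2 + -Real.cos (Real.pi * x) := by linarith [Real.cos_le_one (Real.pi * x)]
  have hR' : 2 + -Real.cos (Real.pi * x) ≤ 3 := by linarith [Real.neg_one_le_cos (Real.pi * x)]
  have hnorm : ‖P.1‖ = 2 + -Real.cos (Real.pi * x) := by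
    rw [hP, norm_mul, Complex.norm_exp_ofReal_mul_I, mul_one, Complex.norm_real, e2,
      Real.norm_of_nonneg (by linarith)]
  have hscale : starScale q w ‖P.1‖ * ‖P.1‖ = w / 2 / Real.cos (halfAngle q * x) := by
    rw [mul_comm, mul_starScale, hnorm, min_eq_right hR, max_eq_left hR, one_mul, starRadius,
      max_eq_left (by linarith), add_zero, sub_add_cancel_left, neg_neg, ← Real.cos_abs (Real.pi * x),
      abs_mul, abs_of_pos hπ, Real.arccos_cos (by positivity) (mul_le_of_le_one_right hπ.le hx),
      ← Real.cos_abs (halfAngle q * x), abs_mul, abs_of_pos hβ,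
      show halfAngle q / Real.pi * (Real.pi * |x|) = halfAngle q * |x| by field_simp]
  refine Prod.ext ?_ ?_
  · have h1 : P.1 = ‖P.1‖ * (Complex.exp ((halfAngle q * x : ℝ) * Complex.I) * edgeDir q k) := by
      rw [← e5, hnorm, hP, e2]
    change (starScale q w ‖P.1‖ : ℂ) * P.1 = chordPoint q w x * edgeDir q k
    rw [chordPoint, ← hscale]
    rw [Complex.ofReal_mul]
    linear_combination (starScale q w ‖P.1‖ : ℂ) * h1
  · change P.2 = _
    rw [hP, e3, neg_neg]

include hq hw in
theorem starRibbon_knot_ambientIsotopic :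
    AmbientIsotopic (starRibbon q w (sheetHeight q w)).knot (torusKnot (2 * q + 1) q) := by
  have h1 := ambientIsotopic_radial (continuous_starScale hq) (starScale_pos hq hw)
    (strictMonoOn_mul_starScale hq hw) zero_le_three (sub_three_le_mul_starScale hq hw)
    (torusKnot (2 * q + 1) q)
  refine AmbientIsotopic.symm ?_
  convert h1 using 1
  have hn : (2 * q + 1 : ℝ) ≠ 0 := by positivity
  have hπ := Real.pi_pos
  ext ⟨z, t⟩
  constructor
  · rintro ⟨i, hz, ht⟩
    obtain ⟨x, hx, rfl⟩ := (mem_segment_iff hq hw _ i z).1 hz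
    obtain ⟨k, rfl⟩ := ZMod.intCast_surjective i
    have ht : t = sheetHeight q w (frame q k (chordPoint q w x * edgeDir q k)) := ht
    rw [frame_edgeDir_mul, sheetHeight_chordPoint hq hw hx] at ht
    refine ⟨_, ⟨(2 * Real.pi * k + Real.pi + Real.pi * x) / (2 * q + 1), rfl⟩, ?_⟩
    rw [ht]
    exact radial_torusKnot_point hq hx k (mul_div_cancel₀ _ hn) rfl
  · rintro ⟨_, ⟨s, rfl⟩, h2⟩
    -- The integer part of ns / (2π) selects the edge, and the fractional part, rescaled to [-1, 1],
    -- the position on it.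
    have hx0 := Int.fract_nonneg ((2 * q + 1) * s / (2 * Real.pi))
    have hx1 := Int.fract_lt_one ((2 * q + 1) * s / (2 * Real.pi))
    have hx : |2 * Int.fract ((2 * q + 1) * s / (2 * Real.pi)) - 1| ≤ 1 := by
      rw [abs_le]; constructor <;> linarith
    have hs : (2 * q + 1) * s = 2 * Real.pi * ⌊(2 * q + 1) * s / (2 * Real.pi)⌋ + Real.pi +
        Real.pi * (2 * Int.fract ((2 * q + 1) * s / (2 * Real.pi)) - 1) := by
      rw [Int.fract]
      field_simp
      ring
    replace h2 := (radial_torusKnot_point hq hx _ hs rfl).symm.trans h2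
    rw [Prod.mk.injEq] at h2
    refine ⟨_, (mem_segment_iff hq hw _ _ z).2 ⟨_, hx, h2.1.symm⟩, ?_⟩
    change t = sheetHeight q w (frame q _ z)
    rw [← h2.1, frame_edgeDir_mul, sheetHeight_chordPoint hq hw hx, h2.2]

end Knot

end RibbonKnot

end

theorem mainTheorem3 (q : ℕ) (hq : 1 < q) :
    (∀ w : ℝ, 0 < w → ∃ R : RibbonKnot.ClosedRibbon (2 * q + 1),
      R.IsFlatFolded ∧ R.width = w ∧
      RibbonKnot.AmbientIsotopic R.knot (RibbonKnot.torusKnot (2 * q + 1) q) ∧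
      R.IsPinwheel (2 * w / Real.sin (Real.pi / (2 * q + 1)))
        (2 * w * Real.cot (Real.pi / (2 * q + 1))) ∧
      R.length / R.width = (2 * q + 1) * Real.cot (Real.pi / (2 * (2 * q + 1)))) ∧
    RibbonKnot.ribbonlength (RibbonKnot.torusKnot (2 * q + 1) q) ≤
      ENNReal.ofReal ((2 * q + 1) * Real.cot (Real.pi / (2 * (2 * q + 1)))) := by
  refine ⟨fun w hw => ⟨RibbonKnot.starRibbon q w (RibbonKnot.sheetHeight q w),
    RibbonKnot.starRibbon_isFlatFolded hq hw, rfl,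
    RibbonKnot.starRibbon_knot_ambientIsotopic hq hw,
    RibbonKnot.starRibbon_isPinwheel hq hw _, RibbonKnot.starRibbon_length hq hw _⟩, ?_⟩
  refine sInf_le ⟨2 * q + 1, inferInstance,
    RibbonKnot.starRibbon q 1 (RibbonKnot.sheetHeight q 1),
    RibbonKnot.starRibbon_isFlatFolded hq one_pos,
    RibbonKnot.starRibbon_knot_ambientIsotopic hq one_pos, ?_⟩
  rw [RibbonKnot.starRibbon_length hq one_pos]
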